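/- Let $p$ be a prime, $k$ an algebraic closure of $\mathbf{F}_p$, and $G=Sp(6)=\{g\in GL_6 : {}^tg\Psi g=\Psi\}$ with $\Psi=\begin{pmatrix}0&-J\\J&0\end{pmatrix}$, where $J$ is the $3\times 3$ antidiagonal matrix of ones. Let $(u_i)$ be the canonical basis of $k^6$, let $P$ (resp. $Q$) be the stabilizer in $G$ of $\mathrm{Span}(u_4,u_5,u_6)$ (resp. $\mathrm{Span}(u_1,u_2,u_3)$), let $L=P\cap Q\simeq GL_3$, let $B$ be the group of lower-triangular matrices in $G$, $B_L=B\cap L$, and let $T$ be the diagonal torus of $G$. Identify $X^*(T)=\mathbf{Z}^3$ by letting $(a_1,a_2,a_3)$ correspond to $\mathrm{diag}(x_1,x_2,x_3,x_3^{-1},x_2^{-1},x_1^{-1})\mapsto x_1^{a_1}x_2^{a_2}x_3^{a_3}$. Let $\varphi$ be the $p$-power Frobenius and let the zip group $E=\{(x,y)\in P\times Q : \varphi(\bar x)=\bar y\}$, where $\bar x,\bar y\in L$ are the Levi components, act on $G$ by $(x,y)\cdot g=xgy^{-1}$. For $\lambda\in X^*(T)$ let $V(\lambda)=\mathrm{Ind}_{B_L}^L(\lambda)$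 be the space of regular functions $h$ on $L$ with $h(lb)=\lambda(b)^{-1}h(l)$ for all $l\in L$, $b\in B_L$ (where $\lambda$ is extended to $B_L$ trivially on the unipotent radical), on which $L$ acts by left translations $(l\cdot h)(x)=h(l^{-1}x)$, and $E$ through $E\to P\to L$. The global sections of the vector bundle $\mathscr V(\lambda)$ on the stack of $G$-zips $[E\backslash G]$ are the regular maps $f:G\to V(\lambda)$ with $f(\varepsilon\cdot g)=\varepsilon f(g)$ for all $\varepsilon\in E$, $g\in G$. Put $$C_{\rm zip}=\{\lambda\in X^*(T) : H^0([E\backslash G],\mathscr V(\lambda))\neq 0\},\qquad \langle C_{\rm zip}\rangle=\{\lambda\in X^*(T) : m\lambda\in C_{\rm zip}\text{ for some integer } m\ge 1\}.$$ For elements $m_1,\dots,m_r$ of $\mathbf{Z}^3$ let $\langle m_1,\dots,m_r\rangle$ be the smallest saturated cone containing them (a cone is an additive submonoid $C$ of $\mathbf{Z}^3$; it is saturated if $mx\in C$ with $m\ge1$ implies $x\in C$). Let $$\eta_1=(p+1,-p^2,-p^2),\quad \eta_2=(1,1,-p(p+1)),\quad \eta_\omega=-(p-1,p-1,p-1),\quad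 S_1=(1,0,-p).$$ 1. One has $\langle C_{\rm zip}\rangle=\langle\eta_1,\eta_2,\eta_\omega,S_1\rangle$. 2. The cone $\langle C_{\rm zip}\rangle$ is the set of $(a_1,a_2,a_3)\in\mathbf{Z}^3$ satisfying $$a_1\ge a_2\ge a_3,\qquad p^2a_1+pa_3+a_2\le 0,\qquad p^2a_2+pa_1+a_3\le 0.$$ -/

import Mathlib

open Matrix

noncomputable section

namespace ZipCone

/-! ### Cones in an abelian group -/

section Cones

variable {M : Type*} [AddCommGroup M]

/-- The saturation `⟨C⟩` of a subset `C` of `M`: all `x` with `m • x ∈ C` for some `m ≥ 1`. -/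
def saturation (C : Set M) : Set M := {x | ∃ m : ℕ, 1 ≤ m ∧ m • x ∈ C}

/-- The smallest saturated cone (additive submonoid) of `M` containing `S`. -/
def sGenerated (S : Set M) : AddSubmonoid M :=
  sInf {C : AddSubmonoid M | S ⊆ C ∧ saturation (C : Set M) = C}

end Cones

/-! ### The symplectic group and its zip datum

The basis `u_1, …, u_{2n}` is indexed by `Fin n ⊕ Fin n`, so that a square matrix of size `2n` is
made of four blocks of size `n`. Varieties over the algebraically closed field `k` are given by
their `k`-points. -/

/-- The index set of the basis `u_1, …, u_n, u_{n+1}, …, u_{2n}`. -/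
abbrev Idx (n : ℕ) : Type := Fin n ⊕ Fin n

/-- The matrix with ones on the antidiagonal and zeros elsewhere. -/
def antidiag (n : ℕ) (R : Type*) [CommRing R] : Matrix (Fin n) (Fin n) R :=
  Matrix.of fun i j => if j = Fin.rev i then 1 else 0

/-- The Gram matrix of the symplectic form. -/
def gram (n : ℕ) (R : Type*) [CommRing R] : Matrix (Idx n) (Idx n) R :=
  Matrix.fromBlocks 0 (-antidiag n R) (antidiag n R) 0

section Groups

variable (n : ℕ) (k : Type*) [Field k]

/-- The symplectic group `G = Sp(2n)`. -/
def Sp : Subgroup (GL (Idx n) k) where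
  carrier := {g | (g : Matrix (Idx n) (Idx n) k)ᵀ * gram n k * g = gram n k}
  mul_mem' := by
    intro a b ha hb
    simp only [Set.mem_ofPred_eq, Units.val_mul, Matrix.transpose_mul] at *
    calc _ = (b : Matrix (Idx n) (Idx n) k)ᵀ *
          ((a : Matrix (Idx n) (Idx n) k)ᵀ * gram n k * a) * b := by
            simp only [Matrix.mul_assoc]
      _ = _ := by rw [ha, hb]
  one_mem' := by simp
  inv_mem' := by
    intro a ha
    simp only [Set.mem_ofPred_eq] at *
    have h1 : (a : Matrix (Idx n) (Idx n) k) * ((a⁻¹ : GL (Idx n) k) : Matrix _ _ k) = 1 := by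
      rw [← Units.val_mul]; simp
    have h2 : ((a⁻¹ : GL (Idx n) k) : Matrix _ _ k)ᵀ * (a : Matrix (Idx n) (Idx n) k)ᵀ = 1 := by
      rw [← Matrix.transpose_mul, h1, Matrix.transpose_one]
    calc _ = ((a⁻¹ : GL (Idx n) k) : Matrix _ _ k)ᵀ *
          ((a : Matrix (Idx n) (Idx n) k)ᵀ * gram n k * (a : Matrix (Idx n) (Idx n) k)) * ((a⁻¹ : GL (Idx n) k) : Matrix _ _ k)
            := by rw [ha]
      _ = (((a⁻¹ : GL (Idx n) k) : Matrix _ _ k)ᵀ * (a : Matrix (Idx n) (Idx n) k)ᵀ) * gram n k *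
          ((a : Matrix (Idx n) (Idx n) k) * ((a⁻¹ : GL (Idx n) k) : Matrix _ _ k)) := by
            simp only [Matrix.mul_assoc]
      _ = _ := by rw [h1, h2]; simp

variable {n k} in
/-- Invertible matrices whose `(i, j)` entry vanishes whenever `b j < b i`. -/
def triangularGL {α : Type*} [LinearOrder α] (b : Idx n → α) : Subgroup (GL (Idx n) k) where
  carrier := {g | Matrix.BlockTriangular (g : Matrix (Idx n) (Idx n) k) b}
  mul_mem' := by
    intro x y hx hy
    simpa using Matrix.BlockTriangular.mul hx hy
  one_mem' := by simpa using Matrix.blockTriangular_one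
  inv_mem' := by
    intro x hx
    have : Invertible (x : Matrix (Idx n) (Idx n) k) := x.invertible
    simpa [Matrix.coe_units_inv] using Matrix.blockTriangular_inv_of_blockTriangular hx

/-- The Borel subgroup `B` of lower-triangular matrices in `G`. -/
def borel : Subgroup (GL (Idx n) k) :=
  Sp n k ⊓ triangularGL (fun i => OrderDual.toDual (toLex i))

/-- The parabolic subgroup `P` of `G` stabilizing `Span(u_{n+1}, …, u_{2n})`: the upper right
block vanishes. -/
def parP : Subgroup (GL (Idx n) k) :=
  Sp n k ⊓ triangularGL (Sum.elim (fun _ => (1 : ℕ)) (fun _ => 0))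

/-- The opposite parabolic subgroup `Q` of `G` stabilizing `Span(u_1, …, u_n)`: the lower left
block vanishes. -/
def parQ : Subgroup (GL (Idx n) k) :=
  Sp n k ⊓ triangularGL (Sum.elim (fun _ => (0 : ℕ)) (fun _ => 1))

/-- The common Levi subgroup `L = P ∩ Q`. -/
def levi : Subgroup (GL (Idx n) k) := parP n k ⊓ parQ n k

/-- The Borel subgroup `B_L = B ∩ L` of `L`. -/
def borelL : Subgroup (GL (Idx n) k) := borel n k ⊓ levi n k

variable {n k}

theorem mem_borel {g : GL (Idx n) k} :
    g ∈ borel n k ↔ g ∈ Sp n k ∧ ∀ i j, toLex i < toLex j → g.1 i j = 0 :=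
  Iff.rfl

theorem mem_parP {g : GL (Idx n) k} :
    g ∈ parP n k ↔ g ∈ Sp n k ∧ g.1.toBlocks₁₂ = 0 := by
  refine and_congr Iff.rfl ⟨fun h => ?_, fun h => ?_⟩
  · ext i j
    exact h (by simp)
  · rintro (i | i) (j | j) hij
    · simp at hij
    · exact congrFun (congrFun h i) j
    · simp at hij
    · simp at hij

theorem mem_parQ {g : GL (Idx n) k} :
    g ∈ parQ n k ↔ g ∈ Sp n k ∧ g.1.toBlocks₂₁ = 0 := by
  refine and_congr Iff.rfl ⟨fun h => ?_, fun h => ?_⟩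
  · ext i j
    exact h (by simp)
  · rintro (i | i) (j | j) hij
    · simp at hij
    · simp at hij
    · exact congrFun (congrFun h i) j
    · simp at hij

/-- The block diagonal part of a matrix. -/
def blockDiag (g : Matrix (Idx n) (Idx n) k) : Matrix (Idx n) (Idx n) k :=
  Matrix.fromBlocks g.toBlocks₁₁ 0 0 g.toBlocks₂₂

theorem blockDiag_one : blockDiag (1 : Matrix (Idx n) (Idx n) k) = 1 := by
  ext (i | i) (j | j) <;> simp [blockDiag, Matrix.toBlocks₁₁, Matrix.toBlocks₂₂, Matrix.one_apply]

theorem blockDiag_mul_lower (x y : Matrix (Idx n) (Idx n) k) (hx : x.toBlocks₁₂ = 0)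
    (hy : y.toBlocks₁₂ = 0) : blockDiag (x * y) = blockDiag x * blockDiag y := by
  conv_lhs => rw [← Matrix.fromBlocks_toBlocks x, ← Matrix.fromBlocks_toBlocks y,
    Matrix.fromBlocks_multiply]
  simp [blockDiag, Matrix.fromBlocks_multiply, hx, hy]

theorem blockDiag_mul_upper (x y : Matrix (Idx n) (Idx n) k) (hx : x.toBlocks₂₁ = 0)
    (hy : y.toBlocks₂₁ = 0) : blockDiag (x * y) = blockDiag x * blockDiag y := by
  conv_lhs => rw [← Matrix.fromBlocks_toBlocks x, ← Matrix.fromBlocks_toBlocks y,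
    Matrix.fromBlocks_multiply]
  simp [blockDiag, Matrix.fromBlocks_multiply, hx, hy]

theorem blockDiag_symplectic (x : Matrix (Idx n) (Idx n) k) (hx : xᵀ * gram n k * x = gram n k)
    (h : x.toBlocks₁₂ = 0 ∨ x.toBlocks₂₁ = 0) :
    (blockDiag x)ᵀ * gram n k * blockDiag x = gram n k := by
  rw [← Matrix.fromBlocks_toBlocks x] at hx
  rcases h with h | h <;>
  · simp only [gram, Matrix.fromBlocks_transpose, Matrix.fromBlocks_multiply, h,
      Matrix.fromBlocks_inj] at hx
    simp only [blockDiag, gram, Matrix.fromBlocks_transpose, Matrix.fromBlocks_multiply,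
      Matrix.fromBlocks_inj]
    simp_all

/-- An element of `G` with invertible block diagonal part gives an element of `L`. -/
theorem mem_levi_of_blockDiag {x y : GL (Idx n) k} (hx : x ∈ Sp n k)
    (h : x.1.toBlocks₁₂ = 0 ∨ x.1.toBlocks₂₁ = 0) (hy : y.1 = blockDiag x.1) :
    y ∈ levi n k := by
  have hS : y ∈ Sp n k := by
    change y.1ᵀ * gram n k * y.1 = gram n k
    rw [hy]
    exact blockDiag_symplectic _ hx h
  exact ⟨mem_parP.2 ⟨hS, by rw [hy]; simp [blockDiag]⟩,
    mem_parQ.2 ⟨hS, by rw [hy]; simp [blockDiag]⟩⟩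

/-- The Levi projection `P → L`, `x ↦ x̄`. -/
def leviP : parP n k →* levi n k where
  toFun x := ⟨⟨blockDiag x.1.1, blockDiag (x⁻¹).1.1,
      by rw [← blockDiag_mul_lower _ _ (mem_parP.1 x.2).2 (mem_parP.1 (x⁻¹).2).2,
            ← Units.val_mul, ← Subgroup.coe_mul, mul_inv_cancel]; exact blockDiag_one,
      by rw [← blockDiag_mul_lower _ _ (mem_parP.1 (x⁻¹).2).2 (mem_parP.1 x.2).2,
            ← Units.val_mul, ← Subgroup.coe_mul, inv_mul_cancel]; exact blockDiag_one⟩,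
    mem_levi_of_blockDiag (x := x.1) (mem_parP.1 x.2).1 (Or.inl (mem_parP.1 x.2).2) rfl⟩
  map_one' := Subtype.ext (Units.ext blockDiag_one)
  map_mul' x y := Subtype.ext (Units.ext
    (blockDiag_mul_lower _ _ (mem_parP.1 x.2).2 (mem_parP.1 y.2).2))

/-- The Levi projection `Q → L`, `y ↦ ȳ`. -/
def leviQ : parQ n k →* levi n k where
  toFun x := ⟨⟨blockDiag x.1.1, blockDiag (x⁻¹).1.1,
      by rw [← blockDiag_mul_upper _ _ (mem_parQ.1 x.2).2 (mem_parQ.1 (x⁻¹).2).2,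
            ← Units.val_mul, ← Subgroup.coe_mul, mul_inv_cancel]; exact blockDiag_one,
      by rw [← blockDiag_mul_upper _ _ (mem_parQ.1 (x⁻¹).2).2 (mem_parQ.1 x.2).2,
            ← Units.val_mul, ← Subgroup.coe_mul, inv_mul_cancel]; exact blockDiag_one⟩,
    mem_levi_of_blockDiag (x := x.1) (mem_parQ.1 x.2).1 (Or.inr (mem_parQ.1 x.2).2) rfl⟩
  map_one' := Subtype.ext (Units.ext blockDiag_one)
  map_mul' x y := Subtype.ext (Units.ext
    (blockDiag_mul_upper _ _ (mem_parQ.1 x.2).2 (mem_parQ.1 y.2).2))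

/-- The `p`-th power Frobenius `φ` on invertible matrices. -/
def frob (n : ℕ) (k : Type*) [Field k] (p : ℕ) [Fact p.Prime] [CharP k p] :
    GL (Idx n) k →* GL (Idx n) k :=
  Matrix.GeneralLinearGroup.map (frobenius k p)

variable (n k)

/-- The zip group `E = {(x, y) ∈ P × Q | φ(x̄) = ȳ}`. -/
def zipGroup (p : ℕ) [Fact p.Prime] [CharP k p] : Subgroup (parP n k × parQ n k) :=
  (((frob n k p).comp ((levi n k).subtype.comp leviP)).comp (MonoidHom.fst _ _)).eqLocus
    (((levi n k).subtype.comp leviQ).comp (MonoidHom.snd _ _))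

variable {n k}

/-- The action `(x, y) · g = x g y⁻¹` of `E` on `G`. -/
def zipAct {p : ℕ} [Fact p.Prime] [CharP k p] (ε : zipGroup n k p) (g : Sp n k) : Sp n k :=
  ⟨(ε.1.1 : GL (Idx n) k) * g * (ε.1.2 : GL (Idx n) k)⁻¹,
    mul_mem (mul_mem (mem_parP.1 ε.1.1.2).1 g.2) (inv_mem (mem_parQ.1 ε.1.2.2).1)⟩

/-! ### Regular functions, the representations `V(λ)` and their global sections -/

/-- Regular functions on a subgroup `H` that is Zariski closed in the space of all `2n × 2n`
matrices (as `G` and `L` are): the restrictions of polynomials in the matrix entries. -/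
def IsRegularFun (H : Subgroup (GL (Idx n) k)) (f : H → k) : Prop :=
  ∃ F : MvPolynomial (Idx n × Idx n) k,
    ∀ x : H, f x = MvPolynomial.eval (fun ij => x.1.1 ij.1 ij.2) F

theorem IsRegularFun.add {H : Subgroup (GL (Idx n) k)} {f g : H → k} (hf : IsRegularFun H f)
    (hg : IsRegularFun H g) : IsRegularFun H (f + g) := by
  obtain ⟨F, hF⟩ := hf
  obtain ⟨F', hF'⟩ := hg
  exact ⟨F + F', fun x => by simp [hF, hF']⟩

theorem IsRegularFun.mul {H : Subgroup (GL (Idx n) k)} {f g : H → k} (hf : IsRegularFun H f)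
    (hg : IsRegularFun H g) : IsRegularFun H (f * g) := by
  obtain ⟨F, hF⟩ := hf
  obtain ⟨F', hF'⟩ := hg
  exact ⟨F * F', fun x => by simp [hF, hF']⟩

theorem isRegularFun_const (H : Subgroup (GL (Idx n) k)) (c : k) :
    IsRegularFun H (fun _ => c) :=
  ⟨MvPolynomial.C c, fun x => by simp⟩

theorem IsRegularFun.translate {H : Subgroup (GL (Idx n) k)} {f : H → k} (hf : IsRegularFun H f)
    (l : H) : IsRegularFun H (fun x => f (l * x)) := by
  obtain ⟨F, hF⟩ := hf
  refine ⟨MvPolynomial.bind₁ (fun ij : Idx n × Idx n =>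
    ∑ m, MvPolynomial.C (l.1.1 ij.1 m) * MvPolynomial.X (m, ij.2)) F, fun x => ?_⟩
  change f (l * x) = _
  rw [hF, ← MvPolynomial.coe_aeval_eq_eval, ← MvPolynomial.coe_aeval_eq_eval]
  simp only [RingHom.coe_coe]
  rw [MvPolynomial.aeval_bind₁]
  congr 2
  funext ij
  simp [Matrix.mul_apply]

/-- The character `diag(x_1, …, x_n, x_n⁻¹, …, x_1⁻¹) ↦ x_1 ^ a_1 ⋯ x_n ^ a_n` of the diagonal
torus `T`, extended to lower-triangular matrices through their diagonal. -/
def torusChar (a : Fin n → ℤ) (b : GL (Idx n) k) : k :=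
  ∏ i, (b.1 (Sum.inl i) (Sum.inl i)) ^ a i

/-- The space `V(λ) = Ind_{B_L}^L λ = H⁰(L / B_L, 𝓛(λ))`: regular functions `h` on `L` with
`h(l b) = λ(b)⁻¹ h(l)` for `b ∈ B_L`. -/
def V (k : Type*) [Field k] (a : Fin n → ℤ) : Submodule k (levi n k → k) where
  carrier := {h | IsRegularFun (levi n k) h ∧
    ∀ l b : levi n k, (b : GL (Idx n) k) ∈ borelL n k →
      h (l * b) = (torusChar a (b : GL (Idx n) k))⁻¹ * h l}
  add_mem' := by
    rintro f g ⟨hf, hf'⟩ ⟨hg, hg'⟩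
    exact ⟨hf.add hg, fun l b hb => by simp [hf' l b hb, hg' l b hb, mul_add]⟩
  zero_mem' := ⟨isRegularFun_const _ 0, fun l b hb => by simp⟩
  smul_mem' := by
    rintro c f ⟨hf, hf'⟩
    exact ⟨(isRegularFun_const _ c).mul hf, fun l b hb => by simp [hf' l b hb]; ring⟩

/-- The action of `L` on `V(λ)` by left translations, `(l · h)(x) = h(l⁻¹ x)`. -/
def rep (k : Type*) [Field k] (a : Fin n → ℤ) : Representation k (levi n k) (V k a) where
  toFun l :=
    { toFun := fun h => ⟨fun x => h.1 (l⁻¹ * x), h.2.1.translate l⁻¹,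
        fun x b hb => by
          change h.1 (l⁻¹ * (x * b)) = _
          rw [← mul_assoc]
          exact h.2.2 _ b hb⟩
      map_add' := fun _ _ => rfl
      map_smul' := fun _ _ => rfl }
  map_one' := by
    ext h x
    simp
  map_mul' l l' := by
    ext h x
    simp [mul_assoc]

/-- A map from `G` to `V(λ)` is regular if it lies in `k[G] ⊗ V(λ)`. -/
def IsRegularMap (a : Fin n → ℤ) (f : Sp n k → V k a) : Prop :=
  ∃ (m : ℕ) (c : Fin m → Sp n k → k) (v : Fin m → V k a),
    (∀ i, IsRegularFun (Sp n k) (c i)) ∧ ∀ g, f g = ∑ i, c i g • v i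

/-- `f : G → V(λ)` is a global section of the automorphic vector bundle `𝒱(λ)` on the stack of
`G`-zips `[E \ G]`: it is regular and `f(ε · g) = ε f(g)` for `ε ∈ E` and `g ∈ G`, where `E` acts
on `V(λ)` through the first projection `E → P` and the Levi projection `P → L`. -/
def IsSection (p : ℕ) [Fact p.Prime] [CharP k p] (a : Fin n → ℤ) (f : Sp n k → V k a) : Prop :=
  IsRegularMap a f ∧
    ∀ (ε : zipGroup n k p) (g : Sp n k), f (zipAct ε g) = rep k a (leviP ε.1.1) (f g)

/-- The zip cone of `Sp(2n)`: the `λ ∈ X^*(T) = ℤ ^ n` such that `𝒱(λ)` has a nonzero global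
section on the stack of `G`-zips. -/
def Czip (n : ℕ) (k : Type*) [Field k] (p : ℕ) [Fact p.Prime] [CharP k p] : Set (Fin n → ℤ) :=
  {a | ∃ f : Sp n k → V k a, IsSection p a f ∧ f ≠ 0}

end Groups

end ZipCone

end

/-! A section `f` is controlled by the function χ (`leviValue`) obtained by evaluating `f` at `1 ∈
L` and restricting to `L ⊆ G`, with `L` identified with `GL_n`. The unipotent radicals of `P` and
`Q` act trivially on V(λ), so on the open cell, where the upper left block `A` is invertible, the
value at 1 depends on `A` alone. The Levi part of the zip group turns χ into a semi-invariant: χ(b A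
φ(b)⁻¹) = λ(b) χ(A) for `b` lower triangular. Moreover `f` is defined on all of `G`, also where `A`
is singular, so χ stays polynomial along curves leaving `GL_n` (`PolyOnCurves`). The open cell is
dense, so χ ≠ 0 when `f ≠ 0`.

Necessity of the inequalities, for n = 3. Twisted conjugates of `A` by a root subgroup and by its
chart at infinity give a function on the projective line twisted by a line bundle; a negative degree
kills it, whence a₁ ≥ a₂ ≥ a₃ (`ge_of_semiInvariant`). For the other two bounds, take `A` in a
normal form with χ(A) ≠ 0 and τ(s) = diag(s^w). The curve τ(s)⁻¹ A φ(τ(s)) has no negative powers of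
s, and semi-invariance reads χ(A) = s^e R(s) with e = Σ wᵢ aᵢ and `R` a polynomial. Setting s = 0
shows that e > 0 is impossible (`weight_nonpos_of_curve`). The weights (p², 1, p) and (p, p², 1)
give the two inequalities.

Sufficiency. A semi-invariant polynomial `F` on matrices yields the section g ↦ (x ↦ F(x⁻¹ A φ(x))).
The determinant, the corner entry, and two 2 × 2 minors built from `A`, φ(A) and A φ(A) realize the
four generators. The inequality cone is the union of two simplicial cones on these generators, so
every element has a positive multiple that is a nonnegative integral combination of them
(`exists_nsmul_mem_of_generators_mem`). -/

namespace ZipCone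

/-! ### Block matrices in Sp(2n) and the isomorphism of L with GL_n -/

section Symplectic

variable {n : ℕ} {k : Type*} [Field k]

theorem antidiag_mul_self : antidiag n k * antidiag n k = 1 := by
  ext i j
  simp only [antidiag, Matrix.mul_apply, Matrix.of_apply, ite_mul, one_mul, zero_mul,
    Finset.sum_ite_eq', Finset.mem_univ, if_true, Fin.rev_rev, Matrix.one_apply]
  simp only [eq_comm]

theorem antidiag_transpose : (antidiag n k)ᵀ = antidiag n k := by
  ext i j
  simp only [antidiag, Matrix.transpose_apply, Matrix.of_apply]
  refine if_congr ?_ rfl rfl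
  rw [eq_comm, Fin.rev_eq_iff, eq_comm]

theorem antidiag_mul_cancel (M : Matrix (Fin n) (Fin n) k) :
    antidiag n k * (antidiag n k * M) = M := by
  rw [← Matrix.mul_assoc, antidiag_mul_self, Matrix.one_mul]

theorem gram_mul_self : gram n k * gram n k = -1 := by
  simp [gram, Matrix.fromBlocks_multiply, antidiag_mul_self, ← Matrix.fromBlocks_one,
    Matrix.fromBlocks_neg]

/-- A matrix preserving the symplectic form, as an element of `Sp`. -/
def mkSp (M : Matrix (Idx n) (Idx n) k) (h : Mᵀ * gram n k * M = gram n k) : Sp n k :=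
  have hl : -(gram n k * Mᵀ * gram n k) * M = 1 := by
    rw [Matrix.neg_mul, Matrix.mul_assoc, Matrix.mul_assoc, ← Matrix.mul_assoc Mᵀ, h,
      gram_mul_self, neg_neg]
  ⟨⟨M, -(gram n k * Mᵀ * gram n k), mul_eq_one_comm.1 hl, hl⟩, h⟩

theorem mkSp_val (M : Matrix (Idx n) (Idx n) k) (h : Mᵀ * gram n k * M = gram n k) :
    (mkSp M h).1.1 = M := rfl

theorem fromBlocks_symplectic_iff {A B C D : Matrix (Fin n) (Fin n) k} :
    (fromBlocks A B C D)ᵀ * gram n k * fromBlocks A B C D = gram n k ↔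
      (Cᵀ * antidiag n k * A = Aᵀ * antidiag n k * C ∧
        Cᵀ * antidiag n k * B - Aᵀ * antidiag n k * D = -antidiag n k) ∧
      Dᵀ * antidiag n k * A - Bᵀ * antidiag n k * C = antidiag n k ∧
        Dᵀ * antidiag n k * B = Bᵀ * antidiag n k * D := by
  simp only [gram, Matrix.fromBlocks_transpose, Matrix.fromBlocks_multiply,
    Matrix.fromBlocks_inj, Matrix.mul_zero, Matrix.mul_neg, zero_add, add_zero, Matrix.neg_mul,
    ← sub_eq_add_neg, sub_eq_zero]
  tauto

/-- The upper left block of a symplectic matrix. -/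
abbrev upperLeft (g : GL (Idx n) k) : Matrix (Fin n) (Fin n) k := g.1.toBlocks₁₁

/-- The element of `L` with a given upper left block. -/
def leviOf (m : GL (Fin n) k) : levi n k :=
  have h : (fromBlocks m.1 0 0 (antidiag n k * (m⁻¹).1ᵀ * antidiag n k))ᵀ * gram n k *
      fromBlocks m.1 0 0 (antidiag n k * (m⁻¹).1ᵀ * antidiag n k) = gram n k := by
    have h1 : m.1ᵀ * (m⁻¹).1ᵀ = 1 := by
      rw [← Matrix.transpose_mul, ← Units.val_mul]; simp
    have h2 : (m⁻¹).1 * m.1 = 1 := by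
      rw [← Units.val_mul]; simp
    rw [fromBlocks_symplectic_iff]
    refine ⟨⟨by simp, ?_⟩, ?_, by simp⟩
    · simp only [Matrix.transpose_zero, Matrix.zero_mul, zero_sub, neg_inj, Matrix.mul_assoc,
        antidiag_mul_cancel]
      rw [← Matrix.mul_assoc, h1, Matrix.one_mul]
    · simp only [Matrix.transpose_mul, antidiag_transpose, Matrix.transpose_transpose,
        Matrix.mul_assoc, antidiag_mul_cancel, h2]
      simp
  ⟨(mkSp _ h).1, mem_parP.2 ⟨(mkSp _ h).2, by simp [mkSp_val]⟩,
    mem_parQ.2 ⟨(mkSp _ h).2, by simp [mkSp_val]⟩⟩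

theorem leviOf_val (m : GL (Fin n) k) : (leviOf m).1.1 =
    fromBlocks m.1 0 0 (antidiag n k * (m⁻¹).1ᵀ * antidiag n k) := rfl

theorem levi_mem_Sp (x : levi n k) : (x : GL (Idx n) k) ∈ Sp n k := (mem_parP.1 x.2.1).1

/-- Elements of `L` are determined by their upper left block. -/
theorem levi_ext {x y : levi n k} (h : upperLeft x.1 = upperLeft y.1) : x = y := by
  have key : ∀ x : levi n k, ∃ A D : Matrix (Fin n) (Fin n) k, x.1.1 = fromBlocks A 0 0 D ∧
      Dᵀ * antidiag n k * A = antidiag n k := by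
    intro x
    have e : x.1.1 = fromBlocks x.1.1.toBlocks₁₁ 0 0 x.1.1.toBlocks₂₂ := by
      conv_lhs => rw [← fromBlocks_toBlocks x.1.1, (mem_parP.1 x.2.1).2, (mem_parQ.1 x.2.2).2]
    refine ⟨_, _, e, ?_⟩
    have h1 : x.1.1ᵀ * gram n k * x.1.1 = gram n k := levi_mem_Sp x
    rw [e, fromBlocks_symplectic_iff] at h1
    simpa using h1.2.1
  obtain ⟨A, D, hx, hxA⟩ := key x
  obtain ⟨A', D', hy, hyA⟩ := key y
  have hA : A = A' := by simpa [upperLeft, hx, hy] using h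
  subst hA
  have inv : (antidiag n k * Dᵀ * antidiag n k) * A = 1 := by
    simp only [Matrix.mul_assoc] at hxA ⊢
    rw [hxA, antidiag_mul_self]
  have inv' : A * (antidiag n k * Dᵀ * antidiag n k) = 1 := mul_eq_one_comm.1 inv
  have hD : Dᵀ * antidiag n k = D'ᵀ * antidiag n k := by
    calc Dᵀ * antidiag n k = (Dᵀ * antidiag n k * A) * (antidiag n k * Dᵀ * antidiag n k) := by
          rw [Matrix.mul_assoc _ A, inv', Matrix.mul_one]
      _ = (D'ᵀ * antidiag n k * A) * (antidiag n k * Dᵀ * antidiag n k) := by rw [hxA, hyA]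
      _ = _ := by rw [Matrix.mul_assoc _ A, inv', Matrix.mul_one]
  have hD' : D = D' := by
    apply Matrix.transpose_injective
    have := congrArg (· * antidiag n k) hD
    simpa [Matrix.mul_assoc, antidiag_mul_self] using this
  exact Subtype.ext (Units.ext (by rw [hx, hy, hD']))

theorem toBlocks₁₁_one_eq : (1 : Matrix (Idx n) (Idx n) k).toBlocks₁₁ = 1 := by
  rw [← fromBlocks_one, toBlocks_fromBlocks₁₁]

theorem toBlocks₁₁_mul_of_lower (x y : Matrix (Idx n) (Idx n) k) (hx : x.toBlocks₁₂ = 0) :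
    (x * y).toBlocks₁₁ = x.toBlocks₁₁ * y.toBlocks₁₁ := by
  conv_lhs => rw [← fromBlocks_toBlocks x, ← fromBlocks_toBlocks y, fromBlocks_multiply]
  simp [hx]

theorem toBlocks₁₁_mul_of_upper (x y : Matrix (Idx n) (Idx n) k) (hy : y.toBlocks₂₁ = 0) :
    (x * y).toBlocks₁₁ = x.toBlocks₁₁ * y.toBlocks₁₁ := by
  conv_lhs => rw [← fromBlocks_toBlocks x, ← fromBlocks_toBlocks y, fromBlocks_multiply]
  simp [hy]

/-- The isomorphism `L → GL_n` taking the upper left block. -/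
def leviGL : levi n k →* GL (Fin n) k where
  toFun x := ⟨upperLeft x.1, upperLeft (x⁻¹).1,
    by rw [← toBlocks₁₁_mul_of_lower _ _ (mem_parP.1 x.2.1).2, ← Units.val_mul,
        ← Subgroup.coe_mul, mul_inv_cancel]
       exact toBlocks₁₁_one_eq,
    by rw [← toBlocks₁₁_mul_of_lower _ _ (mem_parP.1 (x⁻¹).2.1).2, ← Units.val_mul,
        ← Subgroup.coe_mul, inv_mul_cancel]
       exact toBlocks₁₁_one_eq⟩
  map_one' := Units.ext toBlocks₁₁_one_eq
  map_mul' x y := Units.ext (toBlocks₁₁_mul_of_lower _ _ (mem_parP.1 x.2.1).2)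

theorem leviGL_val (x : levi n k) : (leviGL x).1 = upperLeft x.1 := rfl

theorem leviGL_leviOf (m : GL (Fin n) k) : leviGL (leviOf m) = m :=
  Units.ext (by simp [leviGL_val, upperLeft, leviOf_val])

theorem leviOf_leviGL (x : levi n k) : leviOf (leviGL x) = x :=
  levi_ext (by rw [← leviGL_val, leviGL_leviOf, leviGL_val])

theorem leviP_of_levi (x : levi n k) : leviP ⟨x.1, x.2.1⟩ = x :=
  levi_ext (by simp [upperLeft, leviP, blockDiag])

theorem leviQ_of_levi (x : levi n k) : leviQ ⟨x.1, x.2.2⟩ = x :=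
  levi_ext (by simp [upperLeft, leviQ, blockDiag])

theorem upperLeft_leviP (x : parP n k) : upperLeft (leviP x).1 = upperLeft x.1 := by
  simp [upperLeft, leviP, blockDiag]

theorem upperLeft_leviQ (x : parQ n k) : upperLeft (leviQ x).1 = upperLeft x.1 := by
  simp [upperLeft, leviQ, blockDiag]

end Symplectic

/-! ### The zip action on upper left blocks -/

section Zip

variable {n : ℕ} {k : Type*} [Field k] {p : ℕ} [Fact p.Prime] [CharP k p]

/-- The `p`-th power Frobenius on `GL_n`. -/
abbrev frobGL (n : ℕ) (k : Type*) [Field k] (p : ℕ) [Fact p.Prime] [CharP k p] :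
    GL (Fin n) k →* GL (Fin n) k :=
  Matrix.GeneralLinearGroup.map (frobenius k p)

theorem leviGL_leviQ_of_mem {ε : parP n k × parQ n k} (h : ε ∈ zipGroup n k p) :
    leviGL (leviQ ε.2) = frobGL n k p (leviGL (leviP ε.1)) := by
  have h' : frob n k p (leviP ε.1).1 = (leviQ ε.2).1 := h
  exact Units.ext (by
    rw [leviGL_val, ← h']
    rfl)

theorem upperLeft_zipAct (ε : zipGroup n k p) (g : Sp n k) :
    upperLeft (zipAct ε g).1 = (leviGL (leviP ε.1.1)).1 * upperLeft g.1 *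
      ((frobGL n k p (leviGL (leviP ε.1.1)))⁻¹).1 := by
  rw [← leviGL_leviQ_of_mem ε.2, ← map_inv, ← map_inv, leviGL_val, leviGL_val, upperLeft_leviP,
    upperLeft_leviQ, ← toBlocks₁₁_mul_of_lower _ _ (mem_parP.1 ε.1.1.2).2,
    ← toBlocks₁₁_mul_of_upper _ _ (mem_parQ.1 (ε.1.2⁻¹).2).2]
  rfl

/-- The element of the zip group given by an element of the Levi subgroup. -/
theorem exists_zipGroup_levi (l : levi n k) : ∃ ε : zipGroup n k p, leviP ε.1.1 = l := by
  set l' : levi n k := leviOf (frobGL n k p (leviGL l)) with hl'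
  have hf : frob n k p l.1 = l'.1 := by
    have h1 : frob n k p l.1 ∈ Sp n k := by
      have h0 : l.1.1ᵀ * gram n k * l.1.1 = gram n k := levi_mem_Sp l
      have hg : (gram n k).map (frobenius k p) = gram n k := by
        ext (i | i) (j | j) <;> simp [gram, antidiag, apply_ite (frobenius k p)]
      have h2 := congrArg (fun M => M.map (frobenius k p)) h0
      simp only [Matrix.map_mul, hg] at h2
      exact h2
    have hP : frob n k p l.1 ∈ parP n k := mem_parP.2 ⟨h1, by
      ext i j
      have := congrFun (congrFun (mem_parP.1 l.2.1).2 i) j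
      simp only [toBlocks₁₂, of_apply, Matrix.zero_apply] at this ⊢
      simp [frob, this]⟩
    have hQ : frob n k p l.1 ∈ parQ n k := mem_parQ.2 ⟨h1, by
      ext i j
      have := congrFun (congrFun (mem_parQ.1 l.2.2).2 i) j
      simp only [toBlocks₂₁, of_apply, Matrix.zero_apply] at this ⊢
      simp [frob, this]⟩
    have : (⟨_, hP, hQ⟩ : levi n k) = l' := levi_ext (by
      rw [hl', ← leviGL_val (leviOf _), leviGL_leviOf]
      rfl)
    rw [← this]
  refine ⟨⟨(⟨l.1, l.2.1⟩, ⟨l'.1, l'.2.2⟩), ?_⟩, leviP_of_levi l⟩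
  change frob n k p (leviP ⟨l.1, l.2.1⟩).1 = (leviQ ⟨l'.1, l'.2.2⟩).1
  rw [leviP_of_levi, leviQ_of_levi, hf]

/-- The unipotent radicals of `P` and `Q` move an element of the open cell into `L`. -/
theorem exists_zipAct_eq_leviOf (g : Sp n k) (A : GL (Fin n) k) (h : upperLeft g.1 = A.1) :
    ∃ ε : zipGroup n k p, leviP ε.1.1 = 1 ∧ (zipAct ε g).1 = (leviOf A).1 := by
  obtain ⟨B, C, D, hg⟩ : ∃ B C D, g.1.1 = fromBlocks A.1 B C D :=
    ⟨_, _, _, by rw [← h]; exact (fromBlocks_toBlocks _).symm⟩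
  have hs : g.1.1ᵀ * gram n k * g.1.1 = gram n k := g.2
  rw [hg, fromBlocks_symplectic_iff] at hs
  have hA1 : A.1 * (A⁻¹).1 = 1 := by rw [← Units.val_mul]; simp
  have hA2 : (A⁻¹).1 * A.1 = 1 := by rw [← Units.val_mul]; simp
  have hA3 : (A⁻¹).1ᵀ * A.1ᵀ = 1 := by rw [← transpose_mul, hA1, transpose_one]
  -- With this `S`, left multiplication by the unipotent element (1 0; S 1) of `P` clears the lower
  -- left block and moves `g` into `Q`. The symplectic relation between `A` and `C` is what makes
  -- this element symplectic.
  set S : Matrix (Fin n) (Fin n) k := -(C * (A⁻¹).1) with hS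
  have hx : (fromBlocks 1 0 S 1)ᵀ * gram n k * fromBlocks 1 0 S 1 = gram n k := by
    rw [fromBlocks_symplectic_iff]
    refine ⟨⟨?_, by simp⟩, by simp, by simp⟩
    have h1 := congrArg (fun M => (A⁻¹).1ᵀ * M * (A⁻¹).1) hs.1.1
    simp only [Matrix.mul_assoc, hA1] at h1
    rw [← Matrix.mul_assoc _ A.1ᵀ, hA3] at h1
    simp only [Matrix.mul_one, Matrix.one_mul] at h1
    rw [hS, transpose_neg, transpose_mul]
    simp only [Matrix.neg_mul, Matrix.mul_neg, Matrix.mul_one, transpose_one, Matrix.one_mul,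
      Matrix.mul_assoc, h1]
  set x : Sp n k := mkSp _ hx
  have hxP : x.1 ∈ parP n k := mem_parP.2 ⟨x.2, by simp [x, mkSp_val]⟩
  have hq : (x * g).1.1 = fromBlocks A.1 B 0 (S * B + D) := by
    rw [Subgroup.coe_mul, Units.val_mul, hg, mkSp_val, fromBlocks_multiply]
    rw [hS, Matrix.neg_mul, Matrix.mul_assoc, hA2]
    simp
  have hqQ : (x * g).1 ∈ parQ n k := mem_parQ.2 ⟨(x * g).2, by rw [hq]; simp⟩
  set q : parQ n k := ⟨_, hqQ⟩
  have hl : leviQ q = leviOf A := levi_ext (by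
    rw [upperLeft_leviQ, ← leviGL_val (leviOf A), leviGL_leviOf]
    rw [upperLeft, hq, toBlocks_fromBlocks₁₁])
  set l : parQ n k := ⟨(leviOf A).1, (leviOf A).2.2⟩ with hl0
  have hx1 : leviP ⟨x.1, hxP⟩ = 1 := levi_ext (by
    rw [upperLeft_leviP]
    simp only [x, upperLeft, mkSp_val]
    exact toBlocks₁₁_one_eq.symm)
  -- Here q = x g lies in `Q` and has Levi part l, so l⁻¹ q has trivial Levi part, and x g (l⁻¹ q)⁻¹
  -- = l.
  refine ⟨⟨(⟨x.1, hxP⟩, l⁻¹ * q), ?_⟩, hx1, ?_⟩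
  · change frob n k p (leviP ⟨x.1, hxP⟩).1 = (leviQ (l⁻¹ * q)).1
    rw [hx1, map_mul, map_inv, hl, leviQ_of_levi, inv_mul_cancel]
    exact map_one _
  · change x.1 * g.1 * ((l⁻¹ * q : parQ n k) : GL (Idx n) k)⁻¹ = l.1
    have : (q : GL (Idx n) k) = x.1 * g.1 := rfl
    rw [Subgroup.coe_mul, _root_.mul_inv_rev, this, Subgroup.coe_inv, inv_inv]
    group

end Zip

/-! ### Polynomial curves, and lower triangular matrices -/

section Curves

variable {n : ℕ} {k : Type*} [Field k]

/-- A function on `GL_n` which is polynomial in `s` along every curve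
`s ↦ X(s) diag(δ(s)) Y(s)` with `X, Y ∈ GL_n(k[s])`. -/
def PolyOnCurves (χ : GL (Fin n) k → k) : Prop :=
  ∀ (X X' Y Y' : Matrix (Fin n) (Fin n) (Polynomial k)) (δ : Fin n → Polynomial k),
    X * X' = 1 → Y * Y' = 1 → ∃ R : Polynomial k, ∀ (s : k) (A : GL (Fin n) k),
      A.1 = (X * diagonal δ * Y).map (Polynomial.eval s) → χ A = R.eval s

/-- The value at `1 ∈ L` of a map from `G` to `V(λ)`. -/
def valueAtOne {a : Fin n → ℤ} (f : Sp n k → V k a) (g : Sp n k) : k := (f g).1 1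

theorem isRegularFun_sum {H : Subgroup (GL (Idx n) k)} {ι : Type*} (t : Finset ι)
    (c : ι → H → k) (h : ∀ i ∈ t, IsRegularFun H (c i)) :
    IsRegularFun H (fun x => ∑ i ∈ t, c i x) := by
  classical
  induction t using Finset.induction_on with
  | empty => simpa using isRegularFun_const H 0
  | insert i t hi ih =>
    simp only [Finset.sum_insert hi]
    exact (h i (by simp)).add (ih fun j hj => h j (by simp [hj]))

theorem isRegularFun_valueAtOne {a : Fin n → ℤ} {f : Sp n k → V k a} (hf : IsRegularMap a f) :
    IsRegularFun (Sp n k) (valueAtOne f) := by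
  obtain ⟨m, c, v, hc, hfv⟩ := hf
  have : valueAtOne f = fun g => ∑ i, (c i * fun _ : Sp n k => (v i).1 1) g := by
    funext g
    simp [valueAtOne, hfv]
  rw [this]
  exact isRegularFun_sum _ _ fun i _ => (hc i).mul (isRegularFun_const _ _)

theorem IsRegularFun.exists_polynomial {H : Subgroup (GL (Idx n) k)} {h : H → k}
    (hh : IsRegularFun H h) (M : Matrix (Idx n) (Idx n) (Polynomial k)) :
    ∃ R : Polynomial k, ∀ (s : k) (g : H), g.1.1 = M.map (Polynomial.eval s) →
      h g = R.eval s := by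
  obtain ⟨F, hF⟩ := hh
  refine ⟨MvPolynomial.aeval (fun ij : Idx n × Idx n => M ij.1 ij.2) F, fun s g hg => ?_⟩
  have hg' : (fun ij : Idx n × Idx n => g.1.1 ij.1 ij.2) =
      fun ij => Polynomial.aeval s (M ij.1 ij.2) := by
    funext ij
    simp [hg]
  rw [hF, hg', ← Polynomial.coe_aeval_eq_eval, MvPolynomial.comp_aeval_apply]
  rfl

theorem antidiag_mul_apply (M : Matrix (Fin n) (Fin n) k) (i j : Fin n) :
    (antidiag n k * M) i j = M i.rev j := by
  simp [antidiag, Matrix.mul_apply]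

theorem mul_antidiag_apply (M : Matrix (Fin n) (Fin n) k) (i j : Fin n) :
    (M * antidiag n k) i j = M i j.rev := by
  rw [← Matrix.transpose_apply (M * antidiag n k), Matrix.transpose_mul, antidiag_transpose,
    antidiag_mul_apply, Matrix.transpose_apply]

theorem antidiag_map {R S : Type*} [CommRing R] [CommRing S] (φ : R →+* S) :
    (antidiag n R).map φ = antidiag n S := by
  ext i j
  simp [antidiag, apply_ite φ]

/-- Entries of δ may vanish: this is how a curve of upper left blocks that passes through singular
matrices is lifted to `Sp`. -/
theorem diagonal_symplectic (δ : Fin n → k) :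
    (fromBlocks (diagonal δ) (-antidiag n k) (antidiag n k) 0)ᵀ * gram n k *
      fromBlocks (diagonal δ) (-antidiag n k) (antidiag n k) 0 = gram n k := by
  rw [fromBlocks_symplectic_iff]
  simp [antidiag_transpose, antidiag_mul_self, Matrix.mul_assoc]

theorem upperLeft_mul_leviOf (g : GL (Idx n) k) (m m' : GL (Fin n) k) :
    upperLeft ((leviOf m).1 * g * (leviOf m').1) = m.1 * upperLeft g * m'.1 := by
  rw [upperLeft, Units.val_mul, Units.val_mul,
    toBlocks₁₁_mul_of_upper _ _ (mem_parQ.1 (leviOf m').2.2).2,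
    toBlocks₁₁_mul_of_lower _ _ (mem_parP.1 (leviOf m).2.1).2]
  change (leviGL (leviOf m)).1 * _ * (leviGL (leviOf m')).1 = _
  rw [leviGL_leviOf, leviGL_leviOf]

/-- Lower triangular invertible matrices. -/
def LowerTri (b : GL (Fin n) k) : Prop := ∀ i j, i < j → b.1 i j = 0

/-- The character `λ` on lower triangular matrices. -/
def triChar (a : Fin n → ℤ) (b : GL (Fin n) k) : k := ∏ i, b.1 i i ^ a i

theorem LowerTri.inv {b : GL (Fin n) k} (hb : LowerTri b) : LowerTri b⁻¹ := by
  have h : Matrix.BlockTriangular b.1 OrderDual.toDual := fun i j hij => hb i j hij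
  have : Invertible b.1 := b.invertible
  have h' := Matrix.blockTriangular_inv_of_blockTriangular h
  intro i j hij
  rw [Matrix.coe_units_inv]
  exact h' hij

theorem leviOf_mem_borelL {b : GL (Fin n) k} (hb : LowerTri b) :
    (leviOf b).1 ∈ borelL n k := by
  refine ⟨mem_borel.2 ⟨levi_mem_Sp _, ?_⟩, (leviOf b).2⟩
  rintro (i | i) (j | j) hij
  · rw [leviOf_val]
    exact hb i j (by simpa using hij)
  · simp [leviOf_val]
  · simp [leviOf_val]
  · have h := hb.inv j.rev i.rev (Fin.rev_lt_rev.2 (by simpa using hij))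
    rw [leviOf_val, fromBlocks_apply₂₂]
    rwa [mul_antidiag_apply, antidiag_mul_apply, Matrix.transpose_apply]

theorem lowerTri_leviGL {b : levi n k} (hb : (b : GL (Idx n) k) ∈ borelL n k) :
    LowerTri (leviGL b) :=
  fun i j hij => (mem_borel.1 hb.1).2 (Sum.inl i) (Sum.inl j) (by simpa using hij)

theorem torusChar_eq_triChar (a : Fin n → ℤ) (b : levi n k) :
    torusChar a (b : GL (Idx n) k) = triChar a (leviGL b) := rfl

theorem LowerTri.apply_diag_ne_zero {b : GL (Fin n) k} (hb : LowerTri b) (i : Fin n) :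
    b.1 i i ≠ 0 := by
  have hd : b.1.det = ∏ i, b.1 i i :=
    Matrix.det_of_isLowerTriangular _ fun i j hij => hb i j hij
  have h0 : b.1.det ≠ 0 := ((Matrix.isUnit_iff_isUnit_det _).1 b.isUnit).ne_zero
  rw [hd, Finset.prod_ne_zero_iff] at h0
  exact h0 i (Finset.mem_univ i)

theorem triChar_ne_zero (a : Fin n → ℤ) {b : GL (Fin n) k} (hb : LowerTri b) :
    triChar a b ≠ 0 :=
  Finset.prod_ne_zero_iff.2 fun i _ => zpow_ne_zero _ (hb.apply_diag_ne_zero i)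

end Curves

/-! ### From a section to a nonzero semi-invariant function on GL_n -/

section Sections

variable {n : ℕ} {k : Type*} [Field k] {p : ℕ} [Fact p.Prime] [CharP k p]
  {a : Fin n → ℤ} {f : Sp n k → V k a}

/-- The function on `GL_n` attached to a section: its value at `1` along `L ⊆ G`. -/
def leviValue (f : Sp n k → V k a) (A : GL (Fin n) k) : k :=
  valueAtOne f ⟨(leviOf A).1, levi_mem_Sp _⟩

theorem IsSection.apply_zipAct (hf : IsSection p a f) (ε : zipGroup n k p) (g : Sp n k)
    (x : levi n k) : (f (zipAct ε g)).1 x = (f g).1 ((leviP ε.1.1)⁻¹ * x) := by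
  rw [hf.2]
  rfl

/-- The zip group element that moves `g` into `L` has trivial Levi component in `P`, so it acts
trivially on V(λ) and leaves the value unchanged. -/
theorem IsSection.valueAtOne_eq_leviValue (hf : IsSection p a f) {g : Sp n k}
    {A : GL (Fin n) k} (h : upperLeft g.1 = A.1) : valueAtOne f g = leviValue f A := by
  obtain ⟨ε, h1, h2⟩ := exists_zipAct_eq_leviOf (p := p) g A h
  have h3 := hf.apply_zipAct ε g 1
  rw [h1] at h3
  have h4 : zipAct ε g = ⟨(leviOf A).1, levi_mem_Sp _⟩ := Subtype.ext h2
  rw [leviValue, valueAtOne, valueAtOne, ← h4, h3]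
  simp

/-- The curve X δ Y lifts to a polynomial curve in `Sp` with this upper left block: `X` and `Y` lift
to `L` over k[s], and δ lifts by `diagonal_symplectic`. On the lift, a regular function is a
polynomial in s. -/
theorem IsSection.polyOnCurves (hf : IsSection p a f) : PolyOnCurves (leviValue f) := by
  intro X X' Y Y' δ hX hY
  let J := antidiag n (Polynomial k)
  obtain ⟨R, hR⟩ := (isRegularFun_valueAtOne hf.1).exists_polynomial
    (fromBlocks X 0 0 (J * X'ᵀ * J) * fromBlocks (diagonal δ) (-J) J 0 *
      fromBlocks Y 0 0 (J * Y'ᵀ * J))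
  refine ⟨R, fun s A hA => ?_⟩
  set e := Polynomial.evalRingHom s with he
  have unit : ∀ {Z Z' : Matrix (Fin n) (Fin n) (Polynomial k)}, Z * Z' = 1 →
      Z.map e * Z'.map e = 1 := fun h => by
    rw [← Matrix.map_mul, h, Matrix.map_one _ (map_zero e) (map_one e)]
  let U : GL (Fin n) k := ⟨X.map e, X'.map e, unit hX, mul_eq_one_comm.1 (unit hX)⟩
  let W : GL (Fin n) k := ⟨Y.map e, Y'.map e, unit hY, mul_eq_one_comm.1 (unit hY)⟩
  let D : Sp n k := mkSp _ (diagonal_symplectic fun i => e (δ i))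
  let g : Sp n k := ⟨(leviOf U).1 * D.1 * (leviOf W).1,
    mul_mem (mul_mem (levi_mem_Sp _) D.2) (levi_mem_Sp _)⟩
  have hd : (diagonal δ).map e = diagonal fun i => e (δ i) :=
    Matrix.diagonal_map (map_zero e)
  have h1 : upperLeft g.1 = A.1 := by
    rw [upperLeft_mul_leviOf, hA]
    change _ = (X * diagonal δ * Y).map e
    rw [Matrix.map_mul, Matrix.map_mul, hd]
    simp [D, mkSp_val, U, W, upperLeft]
  rw [← hf.valueAtOne_eq_leviValue h1]
  refine hR s g ?_
  change _ = (fromBlocks X 0 0 (J * X'ᵀ * J) * fromBlocks (diagonal δ) (-J) J 0 *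
      fromBlocks Y 0 0 (J * Y'ᵀ * J)).map e
  have hJ : J.map e = antidiag n k := antidiag_map e
  have hJ' : (-J).map e = -antidiag n k := by
    rw [← hJ]
    ext
    simp
  have h0 : (0 : Matrix (Fin n) (Fin n) (Polynomial k)).map e = 0 :=
    Matrix.map_zero _ (map_zero e)
  rw [Matrix.map_mul, Matrix.map_mul, fromBlocks_map, fromBlocks_map, fromBlocks_map,
    Matrix.map_mul, Matrix.map_mul, Matrix.map_mul, Matrix.map_mul, hJ, hJ', h0, hd]
  rfl

/-- Equivariance under the Levi element b moves the evaluation point from 1 to b⁻¹, and the defining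
condition of V(λ) returns it to 1 at the cost of λ(b). -/
theorem IsSection.leviValue_semiInvariant (hf : IsSection p a f) {b : GL (Fin n) k}
    (hb : LowerTri b) (A : GL (Fin n) k) :
    leviValue f (b * A * (frobGL n k p b)⁻¹) = triChar a b * leviValue f A := by
  obtain ⟨ε, hε⟩ := exists_zipGroup_levi (p := p) (leviOf b)
  set g : Sp n k := ⟨(leviOf A).1, levi_mem_Sp _⟩ with hg
  have h1 : upperLeft (zipAct ε g).1 = (b * A * (frobGL n k p b)⁻¹).1 := by
    rw [upperLeft_zipAct, hε, leviGL_leviOf, hg, ← leviGL_val (leviOf A), leviGL_leviOf]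
    rfl
  rw [← hf.valueAtOne_eq_leviValue h1, valueAtOne, hf.apply_zipAct, hε, mul_one]
  have h2 := (f g).2.2 (leviOf b)⁻¹ (leviOf b) (leviOf_mem_borelL hb)
  rw [inv_mul_cancel, torusChar_eq_triChar, leviGL_leviOf] at h2
  change _ = triChar a b * (f g).1 1
  rw [h2, mul_inv_cancel_left₀ (triChar_ne_zero a hb)]

/-- If the rows of `(A | B)` span a Lagrangian subspace, some Lagrangian subspace `(S | 1)ᵀ` is
transversal to it, and so are all its rescalings. -/
theorem exists_symmetric_det_ne_zero {A B : Matrix (Fin n) (Fin n) k} (hsym : A * Bᵀ = B * Aᵀ)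
    (hrank : ∀ y : Fin n → k, y ᵥ* A = 0 → y ᵥ* B = 0 → y = 0) :
    ∃ S : Matrix (Fin n) (Fin n) k, Sᵀ = S ∧ ∀ z : k, z ≠ 0 → (A + z • (B * S)).det ≠ 0 := by
  classical
  obtain ⟨L₁, L₂, D, hD⟩ := Matrix.Pivot.exists_list_transvec_mul_mul_list_transvec_eq_diagonal A
  set P := (L₁.map TransvectionStruct.toMatrix).prod with hP
  set Q := (L₂.map TransvectionStruct.toMatrix).prod with hQ
  have hPd : IsUnit P.det := by rw [hP, TransvectionStruct.det_toMatrix_prod]; exact isUnit_one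
  have hQd : IsUnit Q.det := by rw [hQ, TransvectionStruct.det_toMatrix_prod]; exact isUnit_one
  have hQ1 : Q * Q⁻¹ = 1 := Matrix.mul_nonsing_inv _ hQd
  have hQ2 : Q⁻¹ * Q = 1 := Matrix.nonsing_inv_mul _ hQd
  have hQ3 : (Q⁻¹)ᵀ * Qᵀ = 1 := by rw [← Matrix.transpose_mul, hQ1, Matrix.transpose_one]
  -- After row and column operations `A` becomes diag(D). The symmetric matrix sought is, in these
  -- coordinates, the projector onto the kernel of diag(D).
  let E : Fin n → k := fun i => if D i = 0 then 1 else 0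
  let N := P * B * (Q⁻¹)ᵀ
  have hN : diagonal D * Nᵀ = N * diagonal D := by
    have h1 : diagonal D * Nᵀ = P * (A * Bᵀ) * Pᵀ := by
      simp only [N, ← hD, Matrix.transpose_mul, Matrix.transpose_transpose, Matrix.mul_assoc]
      rw [← Matrix.mul_assoc Q, hQ1, Matrix.one_mul]
    have h2 : N * diagonal D = P * (B * Aᵀ) * Pᵀ := by
      rw [← Matrix.diagonal_transpose D, ← hD]
      simp only [N, Matrix.transpose_mul, Matrix.mul_assoc]
      rw [← Matrix.mul_assoc (Q⁻¹)ᵀ, hQ3, Matrix.one_mul]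
    rw [h1, h2, hsym]
  have hN' : ∀ i j, D i = 0 → D j ≠ 0 → N i j = 0 := by
    intro i j hi hj
    have := congrFun (congrFun hN i) j
    rw [Matrix.diagonal_mul, Matrix.mul_diagonal, hi, zero_mul, eq_comm] at this
    exact (mul_eq_zero.1 this).resolve_right hj
  refine ⟨(Q⁻¹)ᵀ * diagonal E * Q⁻¹, by simp [Matrix.mul_assoc], fun z hz hdet => ?_⟩
  have hconj : P * (A + z • (B * ((Q⁻¹)ᵀ * diagonal E * Q⁻¹))) * Q =
      diagonal D + z • (N * diagonal E) := by
    rw [Matrix.mul_add, Matrix.add_mul, hD, Matrix.mul_smul, Matrix.smul_mul]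
    simp only [N, Matrix.mul_assoc, hQ2, Matrix.mul_one]
  have hdet' : (diagonal D + z • (N * diagonal E)).det = 0 := by
    rw [← hconj, Matrix.det_mul, Matrix.det_mul, hdet]
    simp
  obtain ⟨y, hy0, hy⟩ := Matrix.exists_vecMul_eq_zero_iff.2 hdet'
  have hyj : ∀ j, y j * D j + z * ((y ᵥ* N) j * E j) = 0 := by
    intro j
    have := congrFun hy j
    rwa [Matrix.vecMul_add, Matrix.vecMul_smul, ← Matrix.vecMul_vecMul, Pi.add_apply,
      Pi.smul_apply, Matrix.vecMul_diagonal, Matrix.vecMul_diagonal, smul_eq_mul] at this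
  have hyD : ∀ j, y j * D j = 0 := by
    intro j
    by_cases hj : D j = 0
    · rw [hj, mul_zero]
    · simpa [E, hj] using hyj j
  -- Where `D j = 0` the kernel equation gives this directly. Where `D j ≠ 0`, y is supported on
  -- indices with `D i = 0`, and there `N i j = 0` by the symmetry relation.
  have hyN : y ᵥ* N = 0 := by
    funext j
    by_cases hj : D j = 0
    · simpa [E, hj, hz] using hyj j
    · change ∑ i, y i * N i j = 0
      refine Finset.sum_eq_zero fun i _ => ?_
      by_cases hi : D i = 0
      · rw [hN' i j hi hj, mul_zero]
      · rw [(mul_eq_zero.1 (hyD i)).resolve_right hi, zero_mul]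
  have hyP : y ᵥ* P = 0 := by
    apply hrank
    · have h1 : P * A = diagonal D * Q⁻¹ := by
        rw [← hD, Matrix.mul_assoc, hQ1, Matrix.mul_one]
      rw [Matrix.vecMul_vecMul, h1, ← Matrix.vecMul_vecMul]
      have : y ᵥ* diagonal D = 0 := by
        funext j
        rw [Matrix.vecMul_diagonal, hyD]
        rfl
      rw [this, Matrix.zero_vecMul]
    · have h1 : P * B = N * Qᵀ := by
        rw [Matrix.mul_assoc _ (Q⁻¹)ᵀ, hQ3, Matrix.mul_one]
      rw [Matrix.vecMul_vecMul, h1, ← Matrix.vecMul_vecMul, hyN, Matrix.zero_vecMul]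
  exact hPd.ne_zero (Matrix.exists_vecMul_eq_zero_iff.1 ⟨y, hy0, hyP⟩)

/-- A polynomial curve in `Sp` through a given point whose other points are in the open cell. -/
theorem exists_curve_openCell (g : Sp n k) :
    ∃ M : Matrix (Idx n) (Idx n) (Polynomial k), ∃ c : k → Sp n k,
      (∀ s, (c s).1.1 = M.map (Polynomial.eval s)) ∧ c 0 = g ∧
      ∀ s, s ≠ 0 → (upperLeft (c s).1).det ≠ 0 := by
  set J := antidiag n k with hJ
  have hg : g.1.1 * gram n k * g.1.1ᵀ = gram n k := by
    have h1 : -(gram n k * g.1.1ᵀ * gram n k) * g.1.1 = 1 := by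
      have h : g.1.1ᵀ * gram n k * g.1.1 = gram n k := g.2
      rw [Matrix.neg_mul, Matrix.mul_assoc, Matrix.mul_assoc, ← Matrix.mul_assoc _ _ g.1.1, h,
        gram_mul_self, neg_neg]
    have h2 := mul_eq_one_comm.1 h1
    have h3 := congrArg (fun M => M * gram n k) h2
    simp only [Matrix.mul_neg, Matrix.neg_mul, Matrix.mul_assoc, gram_mul_self, Matrix.mul_one,
      neg_neg, Matrix.one_mul] at h3
    rw [Matrix.mul_assoc, h3]
  obtain ⟨A, B, C, D, hb⟩ : ∃ A B C D, g.1.1 = fromBlocks A B C D :=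
    ⟨_, _, _, _, (fromBlocks_toBlocks _).symm⟩
  have hsym : A * (B * J)ᵀ = B * J * Aᵀ := by
    rw [hb, gram, fromBlocks_transpose, fromBlocks_multiply, fromBlocks_multiply,
      fromBlocks_inj] at hg
    have h1 := hg.1
    simp only [Matrix.mul_zero, zero_add, add_zero, Matrix.mul_neg, Matrix.neg_mul] at h1
    rw [add_neg_eq_zero] at h1
    rw [Matrix.transpose_mul, antidiag_transpose, ← Matrix.mul_assoc, h1]
  have hrank : ∀ y : Fin n → k, y ᵥ* A = 0 → y ᵥ* (B * J) = 0 → y = 0 := by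
    intro y h1 h2
    have h2' : y ᵥ* B = 0 := by
      have := congrArg (fun v => v ᵥ* J) h2
      simpa [Matrix.vecMul_vecMul, Matrix.mul_assoc, hJ, antidiag_mul_self] using this
    have h3 : (Sum.elim y 0) ᵥ* g.1.1 = 0 := by
      rw [hb, Matrix.vecMul_fromBlocks]
      simp [h1, h2']
    have h4 : g.1.1 * (g.1⁻¹).1 = 1 := by rw [← Units.val_mul]; simp
    have h5 : (Sum.elim y 0 : Idx n → k) = 0 := by
      rw [← Matrix.vecMul_one (Sum.elim y 0), ← h4, ← Matrix.vecMul_vecMul, h3,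
        Matrix.zero_vecMul]
    funext i
    exact congrFun h5 (Sum.inl i)
  obtain ⟨S, hS, hdet⟩ := exists_symmetric_det_ne_zero hsym hrank
  have hu : ∀ s : k, (fromBlocks 1 0 (s • (J * S)) 1)ᵀ * gram n k *
      fromBlocks 1 0 (s • (J * S)) 1 = gram n k := by
    intro s
    rw [fromBlocks_symplectic_iff]
    refine ⟨⟨?_, by simp⟩, by simp, by simp⟩
    simp [hS, hJ, antidiag_transpose, antidiag_mul_self, Matrix.mul_assoc, antidiag_mul_cancel]
  -- Right multiplication by (1 0; s J S, 1) replaces the upper left block `A` by A + s B J S,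
  -- invertible for s ≠ 0 by the choice of `S`.
  refine ⟨g.1.1.map Polynomial.C * fromBlocks 1 0 ((Polynomial.X : Polynomial k) •
    (J * S).map Polynomial.C) 1, fun s => g * mkSp _ (hu s), fun s => ?_, ?_, fun s hs => ?_⟩
  · change g.1.1 * _ = _
    change _ = (_ * _ : Matrix _ _ _).map (Polynomial.evalRingHom s)
    rw [Matrix.map_mul, fromBlocks_map]
    congr 1
    · ext i j
      simp
    · change fromBlocks _ _ _ _ = _
      congr 1
      · rw [Matrix.map_one _ (map_zero _) (map_one _)]
      · rw [Matrix.map_zero _ (map_zero _)]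
      · ext i j
        simp [-Matrix.map_mul]
        exact mul_comm _ _
      · rw [Matrix.map_one _ (map_zero _) (map_one _)]
  · apply Subtype.ext
    apply Units.ext
    change g.1.1 * fromBlocks 1 0 ((0 : k) • (J * S)) 1 = g.1.1
    rw [zero_smul, fromBlocks_one, Matrix.mul_one]
  · change (g.1.1 * fromBlocks 1 0 (s • (J * S)) 1).toBlocks₁₁.det ≠ 0
    rw [hb, fromBlocks_multiply, toBlocks_fromBlocks₁₁]
    simpa [Matrix.mul_assoc] using hdet s hs

/-- By equivariance some value at 1 is nonzero. Density of the open cell, in the form of a curve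
through the given point, then moves this point into the cell. -/
theorem IsSection.exists_leviValue_ne_zero [Infinite k] (hf : IsSection p a f) (h0 : f ≠ 0) :
    ∃ A, leviValue f A ≠ 0 := by
  obtain ⟨g, hg⟩ : ∃ g, valueAtOne f g ≠ 0 := by
    by_contra! hall
    refine h0 (funext fun g => Subtype.ext (funext fun x => ?_))
    obtain ⟨ε, hε⟩ := exists_zipGroup_levi (p := p) x⁻¹
    have h1 := hf.apply_zipAct ε g 1
    rw [hε, inv_inv, mul_one] at h1
    rw [← h1]
    exact hall _
  obtain ⟨M, c, hM, hc0, hc⟩ := exists_curve_openCell g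
  obtain ⟨R, hR⟩ := (isRegularFun_valueAtOne hf.1).exists_polynomial M
  have hR0 : Polynomial.X * R ≠ 0 := by
    refine mul_ne_zero Polynomial.X_ne_zero fun h => hg ?_
    rw [← hc0, hR 0 _ (hM 0), h, Polynomial.eval_zero]
  obtain ⟨s, hs⟩ : ∃ s, (Polynomial.X * R).eval s ≠ 0 := by
    by_contra! h
    exact hR0 (Polynomial.funext fun s => by rw [h, Polynomial.eval_zero])
  rw [Polynomial.eval_mul, Polynomial.eval_X] at hs
  have hdet := hc s (left_ne_zero_of_mul hs)
  refine ⟨Matrix.GeneralLinearGroup.mkOfDetNeZero _ hdet, ?_⟩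
  rw [← hf.valueAtOne_eq_leviValue (g := c s) rfl, hR s _ (hM s)]
  exact right_ne_zero_of_mul hs

end Sections

/-! ### Polynomials in s and in s⁻¹ -/

section PolyAux

variable {k : Type*} [Field k] [Infinite k]

theorem polynomial_eq_of_eval_ne_zero {P Q : Polynomial k}
    (h : ∀ s, s ≠ 0 → P.eval s = Q.eval s) : P = Q := by
  have : Polynomial.X * P = Polynomial.X * Q := Polynomial.funext fun s => by
    rw [Polynomial.eval_mul, Polynomial.eval_mul, Polynomial.eval_X]
    rcases eq_or_ne s 0 with rfl | hs
    · simp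
    · rw [h s hs]
  exact mul_left_cancel₀ Polynomial.X_ne_zero this

/-- A line bundle of negative degree on the projective line has no nonzero section. Concretely, the
reverse of `Q` would be X^(deg Q + e) P, of degree exceeding deg Q. -/
theorem polynomial_eq_zero_of_eval_inv {P Q : Polynomial k} {e : ℕ} (he : 0 < e)
    (h : ∀ s, s ≠ 0 → Q.eval s⁻¹ = s ^ e * P.eval s) : P = 0 := by
  have h1 : Q.reverse = Polynomial.X ^ (Q.natDegree + e) * P := by
    refine polynomial_eq_of_eval_ne_zero fun s hs => ?_
    have : Invertible s⁻¹ := invertibleOfNonzero (inv_ne_zero hs)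
    have h2 := Polynomial.eval₂_reverse_mul_pow (RingHom.id k) s⁻¹ Q
    rw [invOf_eq_inv, inv_inv, Polynomial.eval₂_id, Polynomial.eval₂_id, h s hs] at h2
    rw [Polynomial.eval_mul, Polynomial.eval_pow, Polynomial.eval_X, pow_add, mul_assoc, ← h2,
      inv_pow, mul_comm (Q.reverse.eval s), mul_inv_cancel_left₀ (pow_ne_zero _ hs)]
  by_contra hP
  have h3 := Polynomial.reverse_natDegree_le Q
  rw [h1, Polynomial.natDegree_mul (pow_ne_zero _ Polynomial.X_ne_zero) hP,
    Polynomial.natDegree_X_pow] at h3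
  omega

theorem prod_zpow_eq_zpow_sum {k ι : Type*} [Field k] {s : k} (hs : s ≠ 0) (t : Finset ι)
    (m : ι → ℤ) : ∏ i ∈ t, s ^ m i = s ^ ∑ i ∈ t, m i := by
  classical
  induction t using Finset.induction_on with
  | empty => simp
  | insert i t hi ih => rw [Finset.prod_insert hi, Finset.sum_insert hi, ih, zpow_add₀ hs]

end PolyAux

/-! ### Constraints on the weight of a semi-invariant function -/

section Bounds

variable {n : ℕ} {k : Type*} [Field k] {p : ℕ} [Fact p.Prime] [CharP k p]

/-- Semi-invariance under `φ`-conjugation by lower triangular matrices. -/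
def IsSemiInvariant (p : ℕ) [Fact p.Prime] [CharP k p] (a : Fin n → ℤ)
    (χ : GL (Fin n) k → k) : Prop :=
  ∀ b, LowerTri b → ∀ A, χ (b * A * (frobGL n k p b)⁻¹) = triChar a b * χ A

variable {a : Fin n → ℤ} {χ : GL (Fin n) k → k}


theorem map_eval_mul (s : k) (M N : Matrix (Fin n) (Fin n) (Polynomial k)) :
    (M * N).map (Polynomial.eval s) = M.map (Polynomial.eval s) * N.map (Polynomial.eval s) :=
  Matrix.map_mul (f := Polynomial.evalRingHom s)

theorem map_eval_one (s : k) :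
    (1 : Matrix (Fin n) (Fin n) (Polynomial k)).map (Polynomial.eval s) = 1 :=
  Matrix.map_one (Polynomial.evalRingHom s) (map_zero _) (map_one _)

/-- Evaluation of an invertible polynomial matrix. -/
def evalGL (M M' : Matrix (Fin n) (Fin n) (Polynomial k)) (h : M * M' = 1) (s : k) :
    GL (Fin n) k :=
  have h' : M.map (Polynomial.eval s) * M'.map (Polynomial.eval s) = 1 := by
    rw [← map_eval_mul, h, map_eval_one]
  ⟨M.map (Polynomial.eval s), M'.map (Polynomial.eval s), h', mul_eq_one_comm.1 h'⟩

/-- The curve factors as N⁻¹ · 1 · (A φ(N)) with both outer factors invertible over k[s]; Frobenius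
of k[s] is used on `N` because evaluation at s commutes with p-th powers. -/
theorem PolyOnCurves.twistedConj (hχ : PolyOnCurves χ)
    {N N' : Matrix (Fin n) (Fin n) (Polynomial k)} (hN : N * N' = 1) (A : GL (Fin n) k) :
    ∃ R : Polynomial k, ∀ s,
      χ ((evalGL N N' hN s)⁻¹ * A * frobGL n k p (evalGL N N' hN s)) = R.eval s := by
  have hA : A.1.map Polynomial.C * (A⁻¹).1.map Polynomial.C = 1 := by
    rw [← Matrix.map_mul, ← Units.val_mul, mul_inv_cancel]
    exact Matrix.map_one _ (map_zero _) (map_one _)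
  have hF : N.map (frobenius (Polynomial k) p) * N'.map (frobenius (Polynomial k) p) = 1 := by
    rw [← Matrix.map_mul, hN]
    exact Matrix.map_one _ (map_zero _) (map_one _)
  obtain ⟨R, hR⟩ := hχ N' N (A.1.map Polynomial.C * N.map (frobenius (Polynomial k) p))
    (N'.map (frobenius (Polynomial k) p) * (A⁻¹).1.map Polynomial.C) 1 (mul_eq_one_comm.1 hN)
    (by rw [Matrix.mul_assoc, ← Matrix.mul_assoc _ _ ((A⁻¹).1.map _), hF, Matrix.one_mul, hA])
  refine ⟨R, fun s => hR s _ ?_⟩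
  have h1 : (diagonal 1 : Matrix (Fin n) (Fin n) (Polynomial k)) = 1 := Matrix.diagonal_one
  rw [h1, Matrix.mul_one, map_eval_mul, map_eval_mul, ← Matrix.mul_assoc]
  have h2 : (A.1.map Polynomial.C).map (Polynomial.eval s) = A.1 := by
    ext i j
    simp
  have h3 : (N.map (frobenius (Polynomial k) p)).map (Polynomial.eval s) =
      (N.map (Polynomial.eval s)).map (frobenius k p) := by
    ext i j
    simp [frobenius_def]
  rw [h2, h3]
  rfl

variable [Infinite k]

/-- `N` and `G` are two charts of a rational curve in the flag variety, glued by the lower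
triangular b(z). Semi-invariance gives R'(z⁻¹) = z^e R(z) for the twisted conjugates of `A` in the
two charts, so `R` vanishes, and its value at z = 0 is χ(A). -/
theorem eq_zero_of_curve_at_infinity (hχ : PolyOnCurves χ) (hs : IsSemiInvariant p a χ)
    {N N' G G' : Matrix (Fin n) (Fin n) (Polynomial k)} (hN : N * N' = 1) (hG : G * G' = 1)
    (hN0 : N.map (Polynomial.eval 0) = 1) (b : k → Matrix (Fin n) (Fin n) k)
    (hb : ∀ z, z ≠ 0 → N.map (Polynomial.eval z) = G.map (Polynomial.eval z⁻¹) * b z)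
    (htri : ∀ z i j, i < j → b z i j = 0) {e : ℕ} (he : 0 < e)
    (hchar : ∀ z, z ≠ 0 → ∏ i, b z i i ^ a i = z ^ e) (A : GL (Fin n) k) : χ A = 0 := by
  obtain ⟨R, hR⟩ := hχ.twistedConj (p := p) hN A
  obtain ⟨R', hR'⟩ := hχ.twistedConj (p := p) hG A
  have h0 : R = 0 := by
    refine polynomial_eq_zero_of_eval_inv he (Q := R') fun z hz => ?_
    set x := evalGL N N' hN z with hx
    set g := evalGL G G' hG z⁻¹ with hg
    have hbz : (g⁻¹ * x).1 = b z := by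
      have h1 : x.1 = g.1 * b z := hb z hz
      rw [Units.val_mul, h1, ← Matrix.mul_assoc, ← Units.val_mul, inv_mul_cancel]
      exact Matrix.one_mul _
    have hbt : LowerTri (g⁻¹ * x) := fun i j hij => by rw [hbz, htri z i j hij]
    have h2 := hs _ hbt (x⁻¹ * A * frobGL n k p x)
    have h3 : g⁻¹ * x * (x⁻¹ * A * frobGL n k p x) * (frobGL n k p (g⁻¹ * x))⁻¹ =
        g⁻¹ * A * frobGL n k p g := by
      rw [map_mul, map_inv]
      group
    have h4 : triChar a (g⁻¹ * x) = z ^ e := by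
      rw [← hchar z hz, triChar, hbz]
    rw [h3, h4, hR, hR'] at h2
    exact h2
  have h1 : evalGL N N' hN 0 = 1 := Units.ext hN0
  have h2 := hR 0
  rw [h1, h0, Polynomial.eval_zero] at h2
  simpa using h2

/-- If the twisted conjugates of `A` by a one-parameter subgroup lift to a polynomial curve, the
weight of `χ` on this subgroup is not positive. -/
theorem weight_nonpos_of_curve (hχ : PolyOnCurves χ) (hs : IsSemiInvariant p a χ)
    {A : GL (Fin n) k} (hA : χ A ≠ 0) (w : Fin n → ℕ)
    {X X' Y Y' : Matrix (Fin n) (Fin n) (Polynomial k)} {δ : Fin n → Polynomial k}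
    (hX : X * X' = 1) (hY : Y * Y' = 1)
    (h : ∀ (s : k) i j, s ^ w i * (X * diagonal δ * Y).map (Polynomial.eval s) i j =
      A.1 i j * s ^ (p * w j)) : ∑ i, w i * a i ≤ 0 := by
  by_contra! hpos
  obtain ⟨e, he⟩ := Int.eq_ofNat_of_zero_le hpos.le
  obtain ⟨R, hR⟩ := hχ X X' Y Y' δ hX hY
  -- Semi-invariance under τ(s) = diag(s^w), first for s ≠ 0 and then as an identity of polynomials.
  -- At s = 0 it forces χ(A) = 0 when e > 0.
  have h1 : Polynomial.C (χ A) = Polynomial.X ^ e * R := by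
    refine polynomial_eq_of_eval_ne_zero fun s hs0 => ?_
    have hd : (diagonal fun i => s ^ w i : Matrix (Fin n) (Fin n) k).det ≠ 0 := by
      rw [Matrix.det_diagonal]
      exact Finset.prod_ne_zero_iff.2 fun i _ => pow_ne_zero _ hs0
    set τ := Matrix.GeneralLinearGroup.mkOfDetNeZero _ hd with hτ
    have hτv : τ.1 = diagonal fun i => s ^ w i := rfl
    have hτt : LowerTri τ := fun i j hij => by rw [hτv, Matrix.diagonal_apply_ne _ hij.ne]
    have h2 := hs τ hτt (τ⁻¹ * A * frobGL n k p τ)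
    have h3 : τ * (τ⁻¹ * A * frobGL n k p τ) * (frobGL n k p τ)⁻¹ = A := by group
    have h4 : triChar a τ = s ^ e := by
      have he' : ∑ i, (w i : ℤ) * a i = e := he
      rw [triChar, hτv, ← zpow_natCast, ← he', ← prod_zpow_eq_zpow_sum hs0]
      simp only [Matrix.diagonal_apply_eq, _root_.zpow_mul, zpow_natCast]
    have h5 : (τ⁻¹ * A * frobGL n k p τ).1 =
        (X * diagonal δ * Y).map (Polynomial.eval s) := by
      have h6 : τ.1 * (X * diagonal δ * Y).map (Polynomial.eval s) =
          A.1 * (frobGL n k p τ).1 := by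
        have h7 : (frobGL n k p τ).1 = diagonal fun i => s ^ (p * w i) := by
          change τ.1.map (frobenius k p) = _
          rw [hτv, Matrix.diagonal_map (map_zero _)]
          congr 1
          funext i
          simp [frobenius_def, ← pow_mul, mul_comm]
        ext i j
        rw [h7, hτv, Matrix.diagonal_mul, Matrix.mul_diagonal, h]
      rw [Units.val_mul, Units.val_mul, Matrix.mul_assoc, ← h6, ← Matrix.mul_assoc,
        ← Units.val_mul, inv_mul_cancel]
      exact Matrix.one_mul _
    rw [h3, h4, hR s _ h5] at h2
    rw [Polynomial.eval_C, Polynomial.eval_mul, Polynomial.eval_pow, Polynomial.eval_X, h2]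
  have h2 := congrArg (Polynomial.eval 0) h1
  have he0 : e ≠ 0 := by
    rintro rfl
    simp [he] at hpos
  rw [Polynomial.eval_C, Polynomial.eval_mul, Polynomial.eval_pow, Polynomial.eval_X,
    zero_pow he0, zero_mul] at h2
  exact hA h2

theorem exists_add_row_ne_zero (hχ : PolyOnCurves χ) {A : GL (Fin n) k} (hA : χ A ≠ 0)
    {i j v : Fin n} (hij : i ≠ j) (hv : A.1 j v ≠ 0) :
    ∃ (s : k) (B : GL (Fin n) k), χ B ≠ 0 ∧ B.1 i v ≠ 0 ∧
      ∀ u w, B.1 u w = A.1 u w + if u = i then s * A.1 j w else 0 := by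
  have hT : Matrix.transvection i j (Polynomial.X : Polynomial k) *
      Matrix.transvection i j (-Polynomial.X) = 1 := by
    rw [Matrix.transvection_mul_transvection_same _ _ hij, add_neg_cancel, Matrix.transvection_zero]
  have hAC : A.1.map Polynomial.C * (A⁻¹).1.map Polynomial.C = 1 := by
    rw [← Matrix.map_mul, ← Units.val_mul, mul_inv_cancel]
    exact Matrix.map_one _ (map_zero _) (map_one _)
  obtain ⟨R, hR⟩ := hχ _ _ _ _ 1 hT hAC
  have hB : ∀ s, ((evalGL _ _ hT s) * A).1 = (Matrix.transvection i j Polynomial.X * diagonal 1 *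
      A.1.map Polynomial.C).map (Polynomial.eval s) := by
    intro s
    have h1 : (diagonal 1 : Matrix (Fin n) (Fin n) (Polynomial k)) = 1 := Matrix.diagonal_one
    have h2 : (A.1.map Polynomial.C).map (Polynomial.eval s) = A.1 := by
      ext i j
      simp
    rw [h1, Matrix.mul_one, map_eval_mul, h2]
    rfl
  have hent : ∀ s u w, ((evalGL _ _ hT s) * A).1 u w =
      A.1 u w + if u = i then s * A.1 j w else 0 := by
    intro s u w
    have h1 : (Matrix.transvection i j (Polynomial.X : Polynomial k)).map (Polynomial.eval s) =
        Matrix.transvection i j s := by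
      ext u w
      simp [Matrix.transvection, Matrix.single_apply, Matrix.one_apply, apply_ite (Polynomial.eval s)]
    change ((Matrix.transvection i j (Polynomial.X : Polynomial k)).map (Polynomial.eval s) *
      A.1) u w = _
    rw [h1]
    split_ifs with hu
    · rw [hu, Matrix.transvection_mul_apply_same]
    · rw [Matrix.transvection_mul_apply_of_ne _ _ _ _ hu, add_zero]
  -- Both requirements on s are open, each given by a nonzero polynomial: `R` is χ(A) at s = 0, and
  -- the second factor has leading coefficient `A.1 j v`.
  have hne : R * (Polynomial.C (A.1 i v) + Polynomial.X * Polynomial.C (A.1 j v)) ≠ 0 := by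
    refine mul_ne_zero (fun h => hA ?_) fun h => hv ?_
    · have h1 := hR 0 _ (hB 0)
      have h2 : evalGL _ _ hT 0 * A = A := Units.ext (by
        ext u w
        rw [hent]
        simp)
      rwa [h2, h, Polynomial.eval_zero] at h1
    · have h1 := congrArg (fun P => P.coeff 1) h
      simpa using h1
  obtain ⟨s, hs⟩ : ∃ s, (R * (Polynomial.C (A.1 i v) +
      Polynomial.X * Polynomial.C (A.1 j v))).eval s ≠ 0 := by
    by_contra! h
    exact hne (Polynomial.funext fun s => by rw [h, Polynomial.eval_zero])
  rw [Polynomial.eval_mul, ← hR s _ (hB s)] at hs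
  refine ⟨s, evalGL _ _ hT s * A, left_ne_zero_of_mul hs, ?_, hent s⟩
  have := right_ne_zero_of_mul hs
  rw [hent, if_pos rfl, mul_comm s]
  simpa using this

end Bounds

/-! ### The four inequalities for GL_3 -/

section RankThree

variable {k : Type*} [Field k] {p : ℕ} [Fact p.Prime] [CharP k p]
  {a : Fin 3 → ℤ} {χ : GL (Fin 3) k → k}

theorem diagonal_vec_three {R : Type*} [Zero R] (x y z : R) :
    diagonal ![x, y, z] = !![x, 0, 0; 0, y, 0; 0, 0, z] := by
  refine Matrix.ext fun i j => ?_
  fin_cases i <;> fin_cases j <;> rfl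

theorem GL_det_ne_zero (A : GL (Fin 3) k) : A.1.det ≠ 0 :=
  ((Matrix.isUnit_iff_isUnit_det _).1 A.isUnit).ne_zero

theorem det_normalForm {A : Matrix (Fin 3) (Fin 3) k} (h1 : A 1 2 = 0) (h2 : A 2 2 = 0) :
    A.det = A 0 2 * (A 1 0 * A 2 1 - A 1 1 * A 2 0) := by
  rw [Matrix.det_fin_three, h1, h2]
  ring

/-- A lower unipotent matrix. -/
def lowerUnipotent (x y v : k) : GL (Fin 3) k :=
  Matrix.GeneralLinearGroup.mkOfDetNeZero !![1, 0, 0; x, 1, 0; y, v, 1]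
    (by simp [Matrix.det_fin_three])

theorem exists_twistedConj_lowerUnipotent (hs : IsSemiInvariant p a χ) (A : GL (Fin 3) k)
    (x y v : k) : ∃ B : GL (Fin 3) k, χ B = χ A ∧
      B.1 * !![1, 0, 0; x ^ p, 1, 0; y ^ p, v ^ p, 1] =
        !![1, 0, 0; x, 1, 0; y, v, 1] * A.1 := by
  set u := lowerUnipotent x y v
  have hu : u.1 = !![1, 0, 0; x, 1, 0; y, v, 1] := rfl
  refine ⟨u * A * (frobGL 3 k p u)⁻¹, ?_, ?_⟩
  · rw [hs u fun i j hij => ?_]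
    · simp [triChar, hu, Fin.prod_univ_three]
    · rw [hu]
      fin_cases i <;> fin_cases j <;> simp at hij ⊢
  · have hF : !![1, 0, 0; x ^ p, 1, 0; y ^ p, v ^ p, 1] = (frobGL 3 k p u).1 := by
      change _ = u.1.map (frobenius k p)
      ext i j
      rw [hu]
      fin_cases i <;> fin_cases j <;>
        simp [frobenius_def, (Fact.out : p.Prime).ne_zero]
    rw [hF, ← hu, ← Units.val_mul, ← Units.val_mul]
    congr 1
    group

variable [Infinite k]

theorem ge_of_semiInvariant (hχ : PolyOnCurves χ) (hs : IsSemiInvariant p a χ)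
    (h0 : ∃ A, χ A ≠ 0) : a 0 ≥ a 1 ∧ a 1 ≥ a 2 := by
  obtain ⟨A, hA⟩ := h0
  constructor
  · by_contra! hlt
    obtain ⟨e, he⟩ := Int.eq_ofNat_of_zero_le (sub_nonneg.2 hlt.le)
    -- The positive simple root subgroup and its chart at infinity: the transition matrix has
    -- diagonal (z⁻¹, z, 1), so λ takes the value z^(a 1 - a 0) on it. The second case is the same
    -- for the other simple root.
    refine hA (eq_zero_of_curve_at_infinity hχ hs (e := e)
      (N := !![1, Polynomial.X, 0; 0, 1, 0; 0, 0, 1])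
      (N' := !![1, -Polynomial.X, 0; 0, 1, 0; 0, 0, 1])
      (G := !![0, 1, 0; -1, Polynomial.X, 0; 0, 0, 1])
      (G' := !![Polynomial.X, -1, 0; 1, 0, 0; 0, 0, 1])
      ?_ ?_ ?_ (fun z => !![z⁻¹, 0, 0; 1, z, 0; 0, 0, 1]) ?_ ?_ (by omega) ?_ A)
    · refine Matrix.ext fun i j => ?_
      fin_cases i <;> fin_cases j <;> simp [Matrix.mul_apply, Fin.sum_univ_three]
    · refine Matrix.ext fun i j => ?_
      fin_cases i <;> fin_cases j <;> simp [Matrix.mul_apply, Fin.sum_univ_three]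
    · refine Matrix.ext fun i j => ?_
      fin_cases i <;> fin_cases j <;> simp
    · intro z hz
      refine Matrix.ext fun i j => ?_
      fin_cases i <;> fin_cases j <;> simp [Matrix.mul_apply, Fin.sum_univ_three, hz]
    · intro z i j hij
      fin_cases i <;> fin_cases j <;> simp at hij ⊢
    · intro z hz
      rw [← zpow_natCast, show (e : ℤ) = _ from he.symm, sub_eq_add_neg, zpow_add₀ hz]
      simp [Fin.prod_univ_three, mul_comm]
  · by_contra! hlt
    obtain ⟨e, he⟩ := Int.eq_ofNat_of_zero_le (sub_nonneg.2 hlt.le)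
    refine hA (eq_zero_of_curve_at_infinity hχ hs (e := e)
      (N := !![1, 0, 0; 0, 1, Polynomial.X; 0, 0, 1])
      (N' := !![1, 0, 0; 0, 1, -Polynomial.X; 0, 0, 1])
      (G := !![1, 0, 0; 0, 0, 1; 0, -1, Polynomial.X])
      (G' := !![1, 0, 0; 0, Polynomial.X, -1; 0, 1, 0])
      ?_ ?_ ?_ (fun z => !![1, 0, 0; 0, z⁻¹, 0; 0, 1, z]) ?_ ?_ (by omega) ?_ A)
    · refine Matrix.ext fun i j => ?_
      fin_cases i <;> fin_cases j <;> simp [Matrix.mul_apply, Fin.sum_univ_three]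
    · refine Matrix.ext fun i j => ?_
      fin_cases i <;> fin_cases j <;> simp [Matrix.mul_apply, Fin.sum_univ_three]
    · refine Matrix.ext fun i j => ?_
      fin_cases i <;> fin_cases j <;> simp
    · intro z hz
      refine Matrix.ext fun i j => ?_
      fin_cases i <;> fin_cases j <;> simp [Matrix.mul_apply, Fin.sum_univ_three, hz]
    · intro z i j hij
      fin_cases i <;> fin_cases j <;> simp at hij ⊢
    · intro z hz
      rw [← zpow_natCast, show (e : ℤ) = _ from he.symm, sub_eq_add_neg, zpow_add₀ hz]
      simp [Fin.prod_univ_three, mul_comm]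

theorem exists_corner_ne_zero (hχ : PolyOnCurves χ) (h0 : ∃ A, χ A ≠ 0) :
    ∃ A, χ A ≠ 0 ∧ A.1 0 2 ≠ 0 := by
  obtain ⟨A, hA⟩ := h0
  by_cases h : A.1 0 2 = 0
  · obtain ⟨j, hj⟩ : ∃ j, A.1 j 2 ≠ 0 := by
      by_contra! hall
      exact GL_det_ne_zero A (Matrix.det_eq_zero_of_column_eq_zero 2 hall)
    obtain ⟨s, B, hB, hB', -⟩ := exists_add_row_ne_zero hχ hA (i := 0) (j := j)
      (by rintro rfl; exact hj h) hj
    exact ⟨B, hB, hB'⟩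
  · exact ⟨A, hA, h⟩

/-- Twisted conjugation by lower unipotent matrices leaves χ unchanged, so the nonzero corner entry
serves as a pivot to clear the rest of the last column and the middle entry of the first row. -/
theorem exists_normalForm [IsAlgClosed k] (hχ : PolyOnCurves χ) (hs : IsSemiInvariant p a χ)
    (h0 : ∃ A, χ A ≠ 0) : ∃ A, χ A ≠ 0 ∧ A.1 0 2 ≠ 0 ∧ A.1 0 1 = 0 ∧ A.1 1 2 = 0 ∧
      A.1 2 2 = 0 := by
  obtain ⟨A, hA, hc⟩ := exists_corner_ne_zero hχ h0
  obtain ⟨B, hB, hBA⟩ := exists_twistedConj_lowerUnipotent hs A (-(A.1 1 2 / A.1 0 2))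
    (-(A.1 2 2 / A.1 0 2)) 0
  have hB02 : B.1 0 2 = A.1 0 2 := by
    simpa [Matrix.mul_apply, Fin.sum_univ_three] using congrFun (congrFun hBA 0) 2
  have hB12 : B.1 1 2 = 0 := by
    simpa [Matrix.mul_apply, Fin.sum_univ_three, hc] using congrFun (congrFun hBA 1) 2
  have hB22 : B.1 2 2 = 0 := by
    simpa [Matrix.mul_apply, Fin.sum_univ_three, hc] using congrFun (congrFun hBA 2) 2
  -- The column operation is by the Frobenius twist, so its coefficient must be a p-th power.
  obtain ⟨v, hv⟩ := IsAlgClosed.exists_pow_nat_eq (B.1 0 1 / B.1 0 2) (Fact.out : p.Prime).pos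
  obtain ⟨D, hD, hDB⟩ := exists_twistedConj_lowerUnipotent hs B 0 0 v
  have hD02 : D.1 0 2 = B.1 0 2 := by
    simpa [Matrix.mul_apply, Fin.sum_univ_three] using congrFun (congrFun hDB 0) 2
  have hB02' : B.1 0 2 ≠ 0 := by rwa [hB02]
  refine ⟨D, by rwa [hD, hB], by rwa [hD02, hB02], ?_, ?_, ?_⟩
  · have := congrFun (congrFun hDB 0) 1
    simp only [Matrix.mul_apply, Fin.sum_univ_three, hv, hD02] at this
    simpa [mul_div_cancel₀ _ hB02'] using this
  · simpa [Matrix.mul_apply, Fin.sum_univ_three, hB12] using congrFun (congrFun hDB 1) 2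
  · simpa [Matrix.mul_apply, Fin.sum_univ_three, hB12, hB22] using congrFun (congrFun hDB 2) 2

/-- For w = (p², 1, p) the entry (i, j) of the conjugate is scaled by s^(p wⱼ - wᵢ). The exponent is
negative only at (0, 1), where the normal form vanishes, and it is zero at (0, 2) and (2, 1), which
become constant pivots. -/
theorem weight_le_zero_first [IsAlgClosed k] (hχ : PolyOnCurves χ) (hs : IsSemiInvariant p a χ)
    (h0 : ∃ A, χ A ≠ 0) : (p : ℤ) ^ 2 * a 0 + p * a 2 + a 1 ≤ 0 := by
  obtain ⟨A, hA, hc, h01, h12, h22, hq⟩ : ∃ A, χ A ≠ 0 ∧ A.1 0 2 ≠ 0 ∧ A.1 0 1 = 0 ∧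
      A.1 1 2 = 0 ∧ A.1 2 2 = 0 ∧ A.1 2 1 ≠ 0 := by
    obtain ⟨A, hA, hc, h01, h12, h22⟩ := exists_normalForm hχ hs h0
    by_cases hq : A.1 2 1 = 0
    · have hd := GL_det_ne_zero A
      rw [det_normalForm h12 h22, hq, mul_zero, zero_sub] at hd
      have he : A.1 1 1 ≠ 0 := fun h => hd (by simp [h])
      obtain ⟨s, B, hB, hB', hBA⟩ := exists_add_row_ne_zero hχ hA (i := 2) (j := 1)
        (by decide) he
      exact ⟨B, hB, by simpa [hBA] using hc, by simpa [hBA] using h01, by simpa [hBA] using h12,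
        by simp [hBA, h12, h22], hB'⟩
    · exact ⟨A, hA, hc, h01, h12, h22, hq⟩
  obtain ⟨r, hr⟩ : ∃ r, p = r + 1 := ⟨p - 1, by have := (Fact.out : p.Prime).pos; omega⟩
  set α : Polynomial k := Polynomial.C (A.1 0 0) * Polynomial.X ^ (p ^ 2 * r)
  set γ : Polynomial k := Polynomial.C (A.1 2 0) * Polynomial.X ^ (p * r * (p + 1))
  set ε : Polynomial k := Polynomial.C (A.1 1 1 / A.1 2 1) * Polynomial.X ^ r
  -- What remains of the entry (1, 0) after elimination with the pivot at (2, 1). It vanishes at s =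
  -- 0, where the curve leaves `GL_3`. The exponents use r = p - 1, for instance p³ - 1 = r (p² + p
  -- + 1).
  set δ : Polynomial k := Polynomial.C (A.1 1 0) * Polynomial.X ^ (r * (p ^ 2 + p + 1)) - ε * γ
  set c := Polynomial.C (A.1 0 2)
  set c' := Polynomial.C (A.1 0 2)⁻¹
  set q := Polynomial.C (A.1 2 1)
  set q' := Polynomial.C (A.1 2 1)⁻¹
  have hcc : c * c' = 1 := by
    rw [← Polynomial.C_mul, mul_inv_cancel₀ hc, Polynomial.C_1]
  have hqq : q * q' = 1 := by
    rw [← Polynomial.C_mul, mul_inv_cancel₀ hq, Polynomial.C_1]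
  have hprod : !![1, 0, 0; 0, ε, 1; 0, 1, 0] * diagonal ![1, 1, δ] *
      !![α, 0, c; γ, q, 0; 1, 0, 0] = !![α, 0, c; ε * γ + δ, ε * q, 0; γ, q, 0] := by
    rw [diagonal_vec_three]
    refine Matrix.ext fun i j => ?_
    fin_cases i <;> fin_cases j <;>
      simp [Matrix.mul_apply, Fin.sum_univ_three]
  have key := weight_nonpos_of_curve hχ hs hA ![p ^ 2, 1, p]
    (X := !![1, 0, 0; 0, ε, 1; 0, 1, 0]) (X' := !![1, 0, 0; 0, 0, 1; 0, 1, -ε])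
    (Y := !![α, 0, c; γ, q, 0; 1, 0, 0])
    (Y' := !![0, 0, 1; 0, q', -(γ * q'); c', 0, -(α * c')]) (δ := ![1, 1, δ]) ?_ ?_ ?_
  · simp [Fin.sum_univ_three] at key
    linarith
  · refine Matrix.ext fun i j => ?_
    fin_cases i <;> fin_cases j <;> simp [Matrix.mul_apply, Fin.sum_univ_three]
  · refine Matrix.ext fun i j => ?_
    fin_cases i <;> fin_cases j <;> simp [Matrix.mul_apply, Fin.sum_univ_three] <;>
      grind
  · intro s i j
    rw [hprod]
    fin_cases i <;> fin_cases j <;> simp [h01, h12, h22, α, γ, c, q, ε, δ] <;>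
      field_simp <;> rw [hr] <;> ring

/-- For w = (p, p², 1) the only negative exponent is at (1, 2), again a zero of the normal form, and
the constant pivots are at (0, 2) and (1, 0). -/
theorem weight_le_zero_second [IsAlgClosed k] (hχ : PolyOnCurves χ)
    (hs : IsSemiInvariant p a χ) (h0 : ∃ A, χ A ≠ 0) :
    (p : ℤ) ^ 2 * a 1 + p * a 0 + a 2 ≤ 0 := by
  obtain ⟨A, hA, hc, h01, h12, h22, hd⟩ : ∃ A, χ A ≠ 0 ∧ A.1 0 2 ≠ 0 ∧ A.1 0 1 = 0 ∧
      A.1 1 2 = 0 ∧ A.1 2 2 = 0 ∧ A.1 1 0 ≠ 0 := by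
    obtain ⟨A, hA, hc, h01, h12, h22⟩ := exists_normalForm hχ hs h0
    by_cases hd : A.1 1 0 = 0
    · have hdet := GL_det_ne_zero A
      rw [det_normalForm h12 h22, hd, zero_mul, zero_sub] at hdet
      have hg : A.1 2 0 ≠ 0 := fun h => hdet (by simp [h])
      obtain ⟨s, B, hB, hB', hBA⟩ := exists_add_row_ne_zero hχ hA (i := 1) (j := 2)
        (by decide) hg
      exact ⟨B, hB, by simpa [hBA] using hc, by simpa [hBA] using h01, by simp [hBA, h12, h22],
        by simpa [hBA] using h22, hB'⟩
    · exact ⟨A, hA, hc, h01, h12, h22, hd⟩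
  obtain ⟨r, hr⟩ : ∃ r, p = r + 1 := ⟨p - 1, by have := (Fact.out : p.Prime).pos; omega⟩
  set α : Polynomial k := Polynomial.C (A.1 0 0) * Polynomial.X ^ (p * r)
  set η : Polynomial k := Polynomial.C (A.1 1 1) * Polynomial.X ^ (p ^ 2 * r)
  set γ : Polynomial k := Polynomial.C (A.1 2 0 / A.1 1 0) * Polynomial.X ^ (r * (p + 1))
  set δ : Polynomial k := Polynomial.C (A.1 2 1) * Polynomial.X ^ (r * (p ^ 2 + p + 1)) - γ * η
  set c := Polynomial.C (A.1 0 2)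
  set c' := Polynomial.C (A.1 0 2)⁻¹
  set d := Polynomial.C (A.1 1 0)
  set d' := Polynomial.C (A.1 1 0)⁻¹
  have hcc : c * c' = 1 := by
    rw [← Polynomial.C_mul, mul_inv_cancel₀ hc, Polynomial.C_1]
  have hdd : d * d' = 1 := by
    rw [← Polynomial.C_mul, mul_inv_cancel₀ hd, Polynomial.C_1]
  have hprod : !![1, 0, 0; 0, 1, 0; 0, γ, 1] * diagonal ![1, 1, δ] *
      !![α, 0, c; d, η, 0; 0, 1, 0] = !![α, 0, c; d, η, 0; γ * d, γ * η + δ, 0] := by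
    rw [diagonal_vec_three]
    refine Matrix.ext fun i j => ?_
    fin_cases i <;> fin_cases j <;>
      simp [Matrix.mul_apply, Fin.sum_univ_three]
  have key := weight_nonpos_of_curve hχ hs hA ![p, p ^ 2, 1]
    (X := !![1, 0, 0; 0, 1, 0; 0, γ, 1]) (X' := !![1, 0, 0; 0, 1, 0; 0, -γ, 1])
    (Y := !![α, 0, c; d, η, 0; 0, 1, 0])
    (Y' := !![0, d', -(η * d'); 0, 0, 1; c', -(α * c' * d'), α * η * c' * d'])
    (δ := ![1, 1, δ]) ?_ ?_ ?_
  · simp [Fin.sum_univ_three] at key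
    linarith
  · refine Matrix.ext fun i j => ?_
    fin_cases i <;> fin_cases j <;> simp [Matrix.mul_apply, Fin.sum_univ_three]
  · refine Matrix.ext fun i j => ?_
    fin_cases i <;> fin_cases j <;> simp [Matrix.mul_apply, Fin.sum_univ_three] <;>
      grind
  · intro s i j
    rw [hprod]
    fin_cases i <;> fin_cases j <;> simp [h01, h12, h22, α, γ, c, d, η, δ] <;>
      field_simp <;> rw [hr] <;> ring

end RankThree

/-! ### From semi-invariant polynomials to sections -/

section Construction

variable {n : ℕ} {k : Type*} [Field k] {p : ℕ} [Fact p.Prime] [CharP k p]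

/-- The value at a matrix of a polynomial in matrix entries. -/
abbrev evalMat (A : Matrix (Fin n) (Fin n) k) : MvPolynomial (Fin n × Fin n) k →+* k :=
  MvPolynomial.eval fun ij => A ij.1 ij.2

/-- Polynomials on `M_n` that are semi-invariant under `φ`-conjugation by lower triangular
matrices. -/
def IsSemiInvariantPoly (p : ℕ) [Fact p.Prime] [CharP k p] (a : Fin n → ℤ)
    (F : MvPolynomial (Fin n × Fin n) k) : Prop :=
  ∀ b, LowerTri b → ∀ A : Matrix (Fin n) (Fin n) k,
    evalMat (b.1 * A * ((frobGL n k p b)⁻¹).1) F = triChar a b * evalMat A F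

/-- The polynomial `F(x⁻¹ A φ(x))` in the entries of `A`, with coefficients in the polynomials in
the entries of `x ∈ L`. -/
noncomputable def genericConj (p : ℕ) (F : MvPolynomial (Fin n × Fin n) k) :
    MvPolynomial (Fin n × Fin n) (MvPolynomial (Idx n × Idx n) k) :=
  MvPolynomial.eval₂ (MvPolynomial.C.comp MvPolynomial.C)
    -- The entries of x⁻¹ are read off the lower right block of the element of `L`, with reversed
    -- and transposed indices. Hence no division by a determinant occurs.
    (fun ij => ∑ v, (∑ u, MvPolynomial.C (MvPolynomial.X (Sum.inr u.rev, Sum.inr ij.1.rev)) *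
      MvPolynomial.X (u, v)) * MvPolynomial.C (MvPolynomial.X (Sum.inl v, Sum.inl ij.2) ^ p)) F

/-- The evaluation of polynomials in matrix entries at an element of `L`. -/
abbrev evalLevi (x : levi n k) : MvPolynomial (Idx n × Idx n) k →+* k :=
  MvPolynomial.eval fun ij => x.1.1 ij.1 ij.2

theorem evalMat_genericConj (F : MvPolynomial (Fin n × Fin n) k) (x : levi n k)
    (A : Matrix (Fin n) (Fin n) k) :
    evalMat A (MvPolynomial.map (evalLevi x) (genericConj p F)) =
      evalMat (((leviGL x)⁻¹).1 * A * (frobGL n k p (leviGL x)).1) F := by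
  have hinv : ∀ i u, x.1.1 (Sum.inr (Fin.rev u)) (Sum.inr (Fin.rev i)) =
      ((leviGL x)⁻¹).1 i u := by
    intro i u
    conv_lhs => rw [← leviOf_leviGL x, leviOf_val]
    rw [fromBlocks_apply₂₂, mul_antidiag_apply, antidiag_mul_apply, Fin.rev_rev, Fin.rev_rev,
      Matrix.transpose_apply]
  change ((evalMat A).comp (MvPolynomial.map (evalLevi x))) _ = _
  rw [genericConj, MvPolynomial.hom_eval₂]
  have hid : ((evalMat A).comp (MvPolynomial.map (evalLevi x))).comp
      (MvPolynomial.C.comp MvPolynomial.C) = RingHom.id k := by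
    ext c
    simp
  rw [hid]
  refine congrArg (fun h => MvPolynomial.eval₂ (RingHom.id k) h F) (funext fun ij => ?_)
  simp only [RingHom.comp_apply, map_sum, map_mul, MvPolynomial.map_C,
    MvPolynomial.map_X, MvPolynomial.eval_C, MvPolynomial.eval_X, map_pow, hinv]
  rfl

variable [Infinite k] {a : Fin n → ℤ}

/-- Replacing x by x b conjugates x⁻¹ A φ(x) by b⁻¹, so `F` is multiplied by λ(b)⁻¹. As an identity
of polynomials in `A`, this puts every coefficient in V(λ). -/
theorem genericConj_mul {F : MvPolynomial (Fin n × Fin n) k} (hF : IsSemiInvariantPoly p a F)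
    (x b : levi n k) (hb : (b : GL (Idx n) k) ∈ borelL n k) :
    MvPolynomial.map (evalLevi (x * b)) (genericConj p F) =
      MvPolynomial.C (triChar a (leviGL b))⁻¹ *
        MvPolynomial.map (evalLevi x) (genericConj p F) := by
  refine MvPolynomial.funext fun A => ?_
  have h := evalMat_genericConj (p := p) F (x * b) (Matrix.of fun i j => A (i, j))
  have h' := evalMat_genericConj (p := p) F x (Matrix.of fun i j => A (i, j))
  have hA : (fun ij : Fin n × Fin n => (Matrix.of fun i j => A (i, j)) ij.1 ij.2) = A := rfl
  rw [evalMat, hA] at h h'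
  rw [map_mul, MvPolynomial.eval_C, h, h', eq_inv_mul_iff_mul_eq₀
    (triChar_ne_zero a (lowerTri_leviGL hb)), ← hF _ (lowerTri_leviGL hb)]
  congr 2
  have h1 : (leviGL b).1 * ((leviGL b)⁻¹).1 = 1 := by rw [← Units.val_mul]; simp
  have h2 : (frobGL n k p (leviGL b)).1 * ((frobGL n k p (leviGL b))⁻¹).1 = 1 := by
    rw [← Units.val_mul]; simp
  rw [map_mul, map_mul, _root_.mul_inv_rev, Units.val_mul, Units.val_mul]
  simp only [Matrix.mul_assoc, h2, Matrix.mul_one]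
  rw [← Matrix.mul_assoc (leviGL b).1, h1, Matrix.one_mul]

/-- The coefficients of `F(x⁻¹ A φ(x))`, as elements of `V(λ)`. -/
noncomputable def coeffV {F : MvPolynomial (Fin n × Fin n) k} (hF : IsSemiInvariantPoly p a F)
    (m : Fin n × Fin n →₀ ℕ) : V k a :=
  ⟨fun x => evalLevi x ((genericConj p F).coeff m), ⟨⟨_, fun _ => rfl⟩, fun x b hb => by
    have h := congrArg (MvPolynomial.coeff m) (genericConj_mul hF x b hb)
    rw [MvPolynomial.coeff_map, MvPolynomial.coeff_C_mul, MvPolynomial.coeff_map] at h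
    exact h⟩⟩

/-- The section `g ↦ (x ↦ F(x⁻¹ A φ(x)))`, where `A` is the upper left block of `g`. -/
noncomputable def sectionOf {F : MvPolynomial (Fin n × Fin n) k} (hF : IsSemiInvariantPoly p a F)
    (g : Sp n k) : V k a :=
  ∑ m ∈ (genericConj p F).support,
    evalMat (upperLeft g.1) (MvPolynomial.monomial m 1) • coeffV hF m

theorem sectionOf_apply {F : MvPolynomial (Fin n × Fin n) k} (hF : IsSemiInvariantPoly p a F)
    (g : Sp n k) (x : levi n k) : (sectionOf hF g).1 x =
      evalMat (((leviGL x)⁻¹).1 * upperLeft g.1 * (frobGL n k p (leviGL x)).1) F := by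
  rw [← evalMat_genericConj, evalMat, MvPolynomial.eval_map, MvPolynomial.eval₂_eq, sectionOf]
  simp only [AddSubmonoidClass.coe_finsetSum, Finset.sum_apply]
  refine Finset.sum_congr rfl fun m _ => ?_
  change evalMat _ _ * evalLevi x _ = _
  rw [mul_comm, evalMat, MvPolynomial.eval_monomial, one_mul]
  rfl

theorem isSection_sectionOf {F : MvPolynomial (Fin n × Fin n) k}
    (hF : IsSemiInvariantPoly p a F) : IsSection p a (sectionOf hF) := by
  refine ⟨?_, fun ε g => Subtype.ext (funext fun x => ?_)⟩
  · let e := (genericConj p F).support.equivFin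
    refine ⟨_, fun i g => evalMat (upperLeft g.1) (MvPolynomial.monomial (e.symm i).1 1),
      fun i => coeffV hF (e.symm i).1, fun i => ?_, fun g => ?_⟩
    · refine ⟨MvPolynomial.rename (fun ij => (Sum.inl ij.1, Sum.inl ij.2))
        (MvPolynomial.monomial (e.symm i).1 1), fun g => ?_⟩
      rw [MvPolynomial.eval_rename]
      rfl
    · rw [e.symm.sum_comp fun m => evalMat (upperLeft g.1) (MvPolynomial.monomial m.1 1) •
        coeffV hF m.1, sectionOf, ← Finset.sum_coe_sort]
  · change _ = (sectionOf hF g).1 ((leviP ε.1.1)⁻¹ * x)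
    rw [sectionOf_apply, sectionOf_apply, upperLeft_zipAct]
    congr 2
    rw [map_mul, map_mul, _root_.mul_inv_rev, map_inv, map_inv, inv_inv, Units.val_mul,
      Units.val_mul]
    simp only [Matrix.mul_assoc]

theorem exists_GL_evalMat_ne_zero {F : MvPolynomial (Fin n × Fin n) k} (h0 : F ≠ 0) :
    ∃ A : GL (Fin n) k, evalMat A.1 F ≠ 0 := by
  -- A point where the product with the determinant is nonzero is automatically invertible.
  have hne : F * (Matrix.mvPolynomialX (Fin n) (Fin n) k).det ≠ 0 :=
    mul_ne_zero h0 (Matrix.det_mvPolynomialX_ne_zero _ _)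
  obtain ⟨A, hA⟩ : ∃ A, MvPolynomial.eval A
      (F * (Matrix.mvPolynomialX (Fin n) (Fin n) k).det) ≠ 0 := by
    by_contra! h
    exact hne (MvPolynomial.funext fun A => by rw [h, map_zero])
  rw [map_mul] at hA
  have hdet : (Matrix.of fun i j => A (i, j)).det ≠ 0 := by
    have h := right_ne_zero_of_mul hA
    rw [RingHom.map_det] at h
    convert h using 2
    ext i j
    simp [Matrix.mvPolynomialX]
  exact ⟨Matrix.GeneralLinearGroup.mkOfDetNeZero _ hdet, left_ne_zero_of_mul hA⟩

theorem IsSemiInvariantPoly.mem_Czip {F : MvPolynomial (Fin n × Fin n) k}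
    (hF : IsSemiInvariantPoly p a F) (h0 : F ≠ 0) : a ∈ Czip n k p := by
  obtain ⟨A, hA⟩ := exists_GL_evalMat_ne_zero h0
  refine ⟨sectionOf hF, isSection_sectionOf hF, fun h => hA ?_⟩
  have h1 := sectionOf_apply hF ⟨(leviOf A).1, levi_mem_Sp _⟩ 1
  have h2 : upperLeft (leviOf A).1 = A.1 := by rw [← leviGL_val, leviGL_leviOf]
  rw [h, h2] at h1
  simpa using h1.symm

/-- The weights of nonzero semi-invariant polynomials. -/
def weightMonoid (n : ℕ) (k : Type*) [Field k] (p : ℕ) [Fact p.Prime] [CharP k p] :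
    AddSubmonoid (Fin n → ℤ) where
  carrier := {a | ∃ F, IsSemiInvariantPoly (k := k) p a F ∧ F ≠ 0}
  zero_mem' := ⟨1, fun b hb A => by simp [triChar], one_ne_zero⟩
  add_mem' := by
    rintro a a' ⟨F, hF, hF0⟩ ⟨F', hF', hF0'⟩
    refine ⟨F * F', fun b hb A => ?_, mul_ne_zero hF0 hF0'⟩
    have h1 : triChar (a + a') b = triChar a b * triChar a' b := by
      rw [triChar, triChar, triChar, ← Finset.prod_mul_distrib]
      exact Finset.prod_congr rfl fun i _ => zpow_add₀ (hb.apply_diag_ne_zero i) _ _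
    rw [map_mul, map_mul, hF b hb, hF' b hb, h1]
    ring

theorem weightMonoid_le_Czip {a : Fin n → ℤ} (ha : a ∈ weightMonoid n k p) : a ∈ Czip n k p := by
  obtain ⟨F, hF, h0⟩ := ha
  exact hF.mem_Czip h0

end Construction

/-! ### Semi-invariants realizing the four generators -/

section Invariants

variable {k : Type*} [Field k] {p : ℕ} [Fact p.Prime] [CharP k p]

theorem LowerTri.inv_apply_diag {n : ℕ} {b : GL (Fin n) k} (hb : LowerTri b) (i : Fin n) :
    (b⁻¹).1 i i = (b.1 i i)⁻¹ := by
  have h : (b.1 * (b⁻¹).1) i i = 1 := by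
    rw [← Units.val_mul, mul_inv_cancel]
    simp
  rw [Matrix.mul_apply, Finset.sum_eq_single i] at h
  · exact eq_inv_of_mul_eq_one_right h
  · intro j _ hj
    rcases lt_or_gt_of_ne hj with h1 | h1
    · rw [hb.inv j i h1, mul_zero]
    · rw [hb i j h1, zero_mul]
  · simp

theorem LowerTri.frobGL {n : ℕ} {b : GL (Fin n) k} (hb : LowerTri b) :
    LowerTri (ZipCone.frobGL n k p b) := by
  intro i j hij
  change frobenius k p (b.1 i j) = 0
  rw [hb i j hij, map_zero]

theorem frobGL_apply {n : ℕ} (b : GL (Fin n) k) (i j : Fin n) :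
    (frobGL n k p b).1 i j = b.1 i j ^ p := rfl

variable {b c : GL (Fin 3) k}

theorem LowerTri.mul_mul_apply_zero_two (hb : LowerTri b) (hc : LowerTri c)
    (M : Matrix (Fin 3) (Fin 3) k) : (b.1 * M * c.1) 0 2 = b.1 0 0 * M 0 2 * c.1 2 2 := by
  simp [Matrix.mul_apply, Fin.sum_univ_three, hb 0 1 (by decide), hb 0 2 (by decide),
    hc 0 2 (by decide), hc 1 2 (by decide)]

theorem LowerTri.mul_mul_apply_one_two (hb : LowerTri b) (hc : LowerTri c)
    (M : Matrix (Fin 3) (Fin 3) k) :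
    (b.1 * M * c.1) 1 2 = (b.1 1 0 * M 0 2 + b.1 1 1 * M 1 2) * c.1 2 2 := by
  simp [Matrix.mul_apply, Fin.sum_univ_three, hb 1 2 (by decide),
    hc 0 2 (by decide), hc 1 2 (by decide)]

theorem LowerTri.mul_mul_apply_zero_one (hb : LowerTri b) (hc : LowerTri c)
    (M : Matrix (Fin 3) (Fin 3) k) :
    (b.1 * M * c.1) 0 1 = b.1 0 0 * (M 0 1 * c.1 1 1 + M 0 2 * c.1 2 1) := by
  simp [Matrix.mul_apply, Fin.sum_univ_three, hb 0 1 (by decide), hb 0 2 (by decide),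
    hc 0 1 (by decide)]
  ring

theorem evalMat_mvPolynomialX (A : Matrix (Fin 3) (Fin 3) k) (i j : Fin 3) :
    evalMat A (Matrix.mvPolynomialX (Fin 3) (Fin 3) k i j) = A i j := by
  simp [Matrix.mvPolynomialX]

theorem map_frobenius_twistedConj (b : GL (Fin 3) k) (A : Matrix (Fin 3) (Fin 3) k) :
    (b.1 * A * ((frobGL 3 k p b)⁻¹).1).map (frobenius k p) =
      (frobGL 3 k p b).1 * A.map (frobenius k p) *
        ((frobGL 3 k p (frobGL 3 k p b))⁻¹).1 := by
  rw [Matrix.map_mul, Matrix.map_mul, ← map_inv (frobGL 3 k p)]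
  rfl

/-- The inner factors φ(b)⁻¹ and φ(b) cancel, so A φ(A) transforms by b on the left and φ²(b)⁻¹ on
the right. -/
theorem twistedConj_mul_frobenius (b : GL (Fin 3) k) (A : Matrix (Fin 3) (Fin 3) k) :
    b.1 * A * ((frobGL 3 k p b)⁻¹).1 *
        (b.1 * A * ((frobGL 3 k p b)⁻¹).1).map (frobenius k p) =
      b.1 * (A * A.map (frobenius k p)) * ((frobGL 3 k p (frobGL 3 k p b))⁻¹).1 := by
  have h : ((frobGL 3 k p b)⁻¹).1 * (frobGL 3 k p b).1 = 1 := by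
    rw [← Units.val_mul, inv_mul_cancel]
    rfl
  rw [map_frobenius_twistedConj]
  simp only [Matrix.mul_assoc]
  rw [← Matrix.mul_assoc _ (frobGL 3 k p b).1, h, Matrix.one_mul]

theorem det_weight_mem [Infinite k] :
    ![-((p : ℤ) - 1), -((p : ℤ) - 1), -((p : ℤ) - 1)] ∈ weightMonoid 3 k p := by
  refine ⟨(Matrix.mvPolynomialX (Fin 3) (Fin 3) k).det, fun b hb A => ?_,
    Matrix.det_mvPolynomialX_ne_zero _ _⟩
  have hev : ∀ M : Matrix (Fin 3) (Fin 3) k,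
      evalMat M (Matrix.mvPolynomialX (Fin 3) (Fin 3) k).det = M.det := by
    intro M
    rw [RingHom.map_det]
    congr 1
    ext i j
    exact evalMat_mvPolynomialX M i j
  have hd : ∀ {b : GL (Fin 3) k}, LowerTri b → b.1.det = ∏ i, b.1 i i := fun hb =>
    Matrix.det_of_isLowerTriangular _ fun i j hij => hb i j hij
  have hf := (LowerTri.frobGL (p := p) hb)
  have h0 := hb.apply_diag_ne_zero 0
  have h1 := hb.apply_diag_ne_zero 1
  have h2 := hb.apply_diag_ne_zero 2
  rw [hev, hev, Matrix.det_mul, Matrix.det_mul, hd hb, hd hf.inv]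
  simp only [Fin.prod_univ_three, hf.inv_apply_diag, frobGL_apply, triChar, cons_val_zero,
    cons_val_one, cons_val, neg_sub, zpow_sub₀ h0, zpow_sub₀ h1, zpow_sub₀ h2, zpow_one,
    zpow_natCast]
  field_simp

theorem corner_weight_mem : ![1, 0, -(p : ℤ)] ∈ weightMonoid 3 k p := by
  refine ⟨Matrix.mvPolynomialX (Fin 3) (Fin 3) k 0 2, fun b hb A => ?_, ?_⟩
  · have hf := (LowerTri.frobGL (p := p) hb)
    rw [evalMat_mvPolynomialX, evalMat_mvPolynomialX, hb.mul_mul_apply_zero_two hf.inv,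
      hf.inv_apply_diag, frobGL_apply]
    simp [triChar, Fin.prod_univ_three]
    ring
  · simp [Matrix.mvPolynomialX]

/-- `A φ(A)` for the generic matrix `A`. -/
noncomputable def genericNorm (k : Type*) [Field k] (p : ℕ) :
    Matrix (Fin 3) (Fin 3) (MvPolynomial (Fin 3 × Fin 3) k) :=
  Matrix.mvPolynomialX (Fin 3) (Fin 3) k * (Matrix.mvPolynomialX (Fin 3) (Fin 3) k).map (· ^ p)

theorem evalMat_genericNorm (A : Matrix (Fin 3) (Fin 3) k) (i j : Fin 3) :
    evalMat A (genericNorm k p i j) = (A * A.map (frobenius k p)) i j := by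
  rw [genericNorm, Matrix.mul_apply, map_sum, Matrix.mul_apply]
  refine Finset.sum_congr rfl fun l _ => ?_
  rw [map_mul, evalMat_mvPolynomialX, Matrix.map_apply, Matrix.map_apply, map_pow,
    evalMat_mvPolynomialX]
  rfl

/-- The minor of the first two rows formed by the last columns of `A` and A φ(A). Both columns are
multiplied by b on the left, giving b₁b₂, and on the right they scale by b₃^(-p) and b₃^(-p²). -/
theorem columns_weight_mem : ![1, 1, -((p : ℤ) * (p + 1))] ∈ weightMonoid 3 k p := by
  refine ⟨Matrix.mvPolynomialX (Fin 3) (Fin 3) k 0 2 * genericNorm k p 1 2 -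
    Matrix.mvPolynomialX (Fin 3) (Fin 3) k 1 2 * genericNorm k p 0 2, fun b hb A => ?_, ?_⟩
  · have hf := (LowerTri.frobGL (p := p) hb)
    have hff := (LowerTri.frobGL (p := p) hf)
    have h2 := hb.apply_diag_ne_zero 2
    simp only [map_sub, map_mul, evalMat_mvPolynomialX, evalMat_genericNorm,
      twistedConj_mul_frobenius]
    generalize A * A.map (frobenius k p) = N
    rw [hb.mul_mul_apply_zero_two hf.inv, hb.mul_mul_apply_one_two hf.inv,
      hb.mul_mul_apply_zero_two hff.inv, hb.mul_mul_apply_one_two hff.inv, hf.inv_apply_diag,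
      hff.inv_apply_diag, frobGL_apply, frobGL_apply, frobGL_apply]
    have hz : b.1 2 2 ^ (-((p : ℤ) * (p + 1))) = (b.1 2 2 ^ (p * (p + 1)))⁻¹ := by
      rw [_root_.zpow_neg, ← zpow_natCast]
      push_cast
      rfl
    simp only [triChar, Fin.prod_univ_three, cons_val_zero, cons_val_one, cons_val, zpow_one, hz]
    field_simp
    ring
  · intro h
    have h1 := congrArg (evalMat !![0, 0, 1; 1, 0, 0; 0, 0, 0]) h
    simp only [map_sub, map_mul, evalMat_mvPolynomialX, evalMat_genericNorm, map_zero] at h1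
    simp [Matrix.mul_apply, Fin.sum_univ_three] at h1

/-- The minor of the last two columns formed by the first rows of φ(A) and A φ(A). Both rows are
multiplied by φ²(b)⁻¹ on the right, giving (b₂b₃)^(-p²), and on the left they scale by b₁^p and b₁.
-/
theorem rows_weight_mem :
    ![(p : ℤ) + 1, -((p : ℤ) ^ 2), -((p : ℤ) ^ 2)] ∈ weightMonoid 3 k p := by
  refine ⟨Matrix.mvPolynomialX (Fin 3) (Fin 3) k 0 1 ^ p * genericNorm k p 0 2 -
    Matrix.mvPolynomialX (Fin 3) (Fin 3) k 0 2 ^ p * genericNorm k p 0 1, fun b hb A => ?_, ?_⟩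
  · have hf := (LowerTri.frobGL (p := p) hb)
    have hff := (LowerTri.frobGL (p := p) hf)
    have h1 := hb.apply_diag_ne_zero 1
    have h2 := hb.apply_diag_ne_zero 2
    have hpow : ∀ (M : Matrix (Fin 3) (Fin 3) k) i j, M i j ^ p = M.map (frobenius k p) i j :=
      fun M i j => rfl
    simp only [map_sub, map_mul, map_pow, evalMat_mvPolynomialX, evalMat_genericNorm,
      twistedConj_mul_frobenius]
    rw [hpow, hpow, hpow A, hpow A, map_frobenius_twistedConj]
    generalize A * A.map (frobenius k p) = N
    generalize A.map (frobenius k p) = M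
    rw [hb.mul_mul_apply_zero_two hff.inv, hb.mul_mul_apply_zero_one hff.inv,
      hf.mul_mul_apply_zero_two hff.inv, hf.mul_mul_apply_zero_one hff.inv, hff.inv_apply_diag,
      hff.inv_apply_diag]
    simp only [frobGL_apply]
    have hz : ∀ x : k, x ^ (-((p : ℤ) ^ 2)) = ((x ^ p) ^ p)⁻¹ := by
      intro x
      rw [_root_.zpow_neg, ← pow_mul, ← zpow_natCast, sq]
      push_cast
      rfl
    have hz' : b.1 0 0 ^ ((p : ℤ) + 1) = b.1 0 0 ^ p * b.1 0 0 := by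
      rw [zpow_add₀ (hb.apply_diag_ne_zero 0), zpow_one, zpow_natCast]
    simp only [triChar, Fin.prod_univ_three, cons_val_zero, cons_val_one, cons_val, hz, hz']
    ring
  · intro h
    have h1 := congrArg (evalMat !![0, 0, 1; 0, 0, 0; 0, 1, 0]) h
    simp only [map_sub, map_mul, map_pow, evalMat_mvPolynomialX, evalMat_genericNorm,
      map_zero] at h1
    simp [Matrix.mul_apply, Fin.sum_univ_three, (Fact.out : p.Prime).ne_zero] at h1

end Invariants

/-! ### The inequality cone and its generators -/

section Cone

/-- The cone in `ℤ ^ 3` cut out by the four inequalities. -/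
def inequalityCone (p : ℕ) : AddSubmonoid (Fin 3 → ℤ) where
  carrier := {a | (a 0 ≥ a 1 ∧ a 1 ≥ a 2) ∧ (p : ℤ) ^ 2 * a 0 + p * a 2 + a 1 ≤ 0 ∧
    (p : ℤ) ^ 2 * a 1 + p * a 0 + a 2 ≤ 0}
  zero_mem' := by simp
  add_mem' := by
    rintro a b ⟨⟨h1, h2⟩, h3, h4⟩ ⟨⟨h5, h6⟩, h7, h8⟩
    simp only [Set.mem_ofPred_eq, Pi.add_apply]
    refine ⟨⟨?_, ?_⟩, ?_, ?_⟩ <;> linarith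

theorem mem_inequalityCone_of_nsmul {p m : ℕ} (hm : 1 ≤ m) {a : Fin 3 → ℤ}
    (h : m • a ∈ inequalityCone p) : a ∈ inequalityCone p := by
  obtain ⟨⟨h1, h2⟩, h3, h4⟩ := h
  have hm' : (0 : ℤ) < m := by exact_mod_cast hm
  simp only [Pi.smul_apply, nsmul_eq_mul] at h1 h2 h3 h4
  refine ⟨⟨le_of_mul_le_mul_left h1 hm', le_of_mul_le_mul_left h2 hm'⟩, ?_, ?_⟩ <;>
  · refine le_of_mul_le_mul_left ?_ hm'
    linarith

theorem exists_nsmul_mem_of_generators_mem {p : ℕ} (hp : 1 < p) {C : AddSubmonoid (Fin 3 → ℤ)}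
    (h1 : ![(p : ℤ) + 1, -((p : ℤ) ^ 2), -((p : ℤ) ^ 2)] ∈ C)
    (h2 : ![1, 1, -((p : ℤ) * (p + 1))] ∈ C)
    (h3 : ![-((p : ℤ) - 1), -((p : ℤ) - 1), -((p : ℤ) - 1)] ∈ C)
    (h4 : ![1, 0, -(p : ℤ)] ∈ C) {a : Fin 3 → ℤ} (ha : a ∈ inequalityCone p) :
    ∃ m : ℕ, 1 ≤ m ∧ m • a ∈ C := by
  obtain ⟨⟨hx, hy⟩, hu, hv⟩ := ha
  have hp' : (1 : ℤ) < p := by exact_mod_cast hp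
  have hsmul : ∀ {t : ℤ} {b : Fin 3 → ℤ}, 0 ≤ t → b ∈ C → t • b ∈ C := by
    intro t b ht hb
    lift t to ℕ using ht
    rw [natCast_zsmul]
    exact C.nsmul_mem hb t
  have hcube : (0 : ℤ) < p ^ 3 - 1 := by nlinarith
  -- The plane of equality contains S₁ and η_ω and cuts the cone into two simplicial cones, spanned
  -- by these two together with η₁ or η₂ respectively. The coefficient of each generator is a
  -- multiple of the linear form vanishing on the other two, and `m` clears the denominators.
  rcases le_total (a 1 - a 2) (p * (a 0 - a 1)) with hc | hc
  · have hm : (0 : ℤ) < p * (p ^ 3 - 1) := by positivity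
    obtain ⟨m, hm'⟩ := Int.eq_ofNat_of_zero_le hm.le
    refine ⟨m, by exact_mod_cast hm'.subst (motive := fun z => 0 < z) hm, ?_⟩
    have key : m • a = ((a 1 - a 2) * ((p : ℤ) ^ 3 - 1)) • ![1, 0, -(p : ℤ)] +
        ((p * (a 0 - a 1) - (a 1 - a 2)) * ((p : ℤ) - 1)) •
          ![(p : ℤ) + 1, -((p : ℤ) ^ 2), -((p : ℤ) ^ 2)] +
        (p * -((p : ℤ) ^ 2 * a 0 + p * a 2 + a 1)) •
          ![-((p : ℤ) - 1), -((p : ℤ) - 1), -((p : ℤ) - 1)] := by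
      rw [← natCast_zsmul, show (m : ℤ) = _ from hm'.symm]
      funext i
      fin_cases i <;> simp <;> ring
    rw [key]
    refine C.add_mem (C.add_mem (hsmul ?_ h4) (hsmul ?_ h1)) (hsmul ?_ h3)
    · exact mul_nonneg (by linarith) hcube.le
    · exact mul_nonneg (by linarith) (by linarith)
    · exact mul_nonneg (by linarith) (by linarith)
  · obtain ⟨m, hm'⟩ := Int.eq_ofNat_of_zero_le hcube.le
    refine ⟨m, by exact_mod_cast hm'.subst (motive := fun z => 0 < z) hcube, ?_⟩
    have key : m • a = ((a 0 - a 1) * ((p : ℤ) ^ 3 - 1)) • ![1, 0, -(p : ℤ)] +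
        ((a 1 - a 2 - p * (a 0 - a 1)) * ((p : ℤ) - 1)) • ![1, 1, -((p : ℤ) * (p + 1))] +
        (-((p : ℤ) ^ 2 * a 1 + p * a 0 + a 2)) •
          ![-((p : ℤ) - 1), -((p : ℤ) - 1), -((p : ℤ) - 1)] := by
      rw [← natCast_zsmul, show (m : ℤ) = _ from hm'.symm]
      funext i
      fin_cases i <;> simp <;> ring
    rw [key]
    refine C.add_mem (C.add_mem (hsmul ?_ h4) (hsmul ?_ h2)) (hsmul ?_ h3)
    · exact mul_nonneg (by linarith) hcube.le
    · exact mul_nonneg (by linarith) (by linarith)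
    · linarith

theorem sGenerated_eq_inequalityCone {p : ℕ} (hp : 1 < p) :
    sGenerated {![(p : ℤ) + 1, -((p : ℤ) ^ 2), -((p : ℤ) ^ 2)],
      ![1, 1, -((p : ℤ) * (p + 1))],
      ![-((p : ℤ) - 1), -((p : ℤ) - 1), -((p : ℤ) - 1)],
      ![1, 0, -(p : ℤ)]} = inequalityCone p := by
  have hp' : (1 : ℤ) < p := by exact_mod_cast hp
  have hp4 : (p : ℤ) ≤ p ^ 4 := le_self_pow₀ hp'.le (by norm_num)
  apply le_antisymm
  · refine sInf_le ⟨?_, ?_⟩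
    · intro a ha
      simp only [Set.mem_insert_iff, Set.mem_singleton_iff] at ha
      rcases ha with rfl | rfl | rfl | rfl <;> refine ⟨⟨?_, ?_⟩, ?_, ?_⟩ <;>
        simp only [cons_val_zero, cons_val_one, cons_val] <;> nlinarith
    · refine Set.Subset.antisymm ?_ fun a ha => ⟨1, le_rfl, by simpa using ha⟩
      rintro a ⟨m, hm, ha⟩
      exact mem_inequalityCone_of_nsmul hm ha
  · refine le_sInf ?_
    rintro C ⟨hC, hsat⟩ a ha
    obtain ⟨m, hm, hma⟩ := exists_nsmul_mem_of_generators_mem hp (hC (by simp)) (hC (by simp))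
      (hC (by simp)) (hC (by simp)) ha
    have : a ∈ saturation (C : Set (Fin 3 → ℤ)) := ⟨m, hm, hma⟩
    rwa [hsat] at this

theorem saturation_Czip_eq {k : Type*} [Field k] [IsAlgClosed k] {p : ℕ} [Fact p.Prime]
    [CharP k p] : saturation (Czip 3 k p) = inequalityCone p := by
  have : Infinite k := IsAlgClosed.instInfinite
  ext a
  constructor
  · rintro ⟨m, hm, f, hf, h0⟩
    have h := hf.exists_leviValue_ne_zero h0
    have hs : IsSemiInvariant p (m • a) (leviValue f) :=
      fun b hb A => hf.leviValue_semiInvariant hb A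
    exact mem_inequalityCone_of_nsmul hm ⟨ge_of_semiInvariant hf.polyOnCurves hs h,
      weight_le_zero_first hf.polyOnCurves hs h, weight_le_zero_second hf.polyOnCurves hs h⟩
  · intro ha
    obtain ⟨m, hm, hma⟩ := exists_nsmul_mem_of_generators_mem (Fact.out : p.Prime).one_lt
      (rows_weight_mem (k := k)) columns_weight_mem det_weight_mem corner_weight_mem ha
    exact ⟨m, hm, weightMonoid_le_Czip hma⟩

end Cone

end ZipCone

theorem mainTheorem7 (p : ℕ) [Fact p.Prime] (k : Type*) [Field k] [CharP k p]
    [Algebra (ZMod p) k] [IsAlgClosure (ZMod p) k] :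
    ZipCone.saturation (ZipCone.Czip 3 k p) =
        (ZipCone.sGenerated
          {![(p : ℤ) + 1, -((p : ℤ) ^ 2), -((p : ℤ) ^ 2)],
           ![1, 1, -((p : ℤ) * (p + 1))],
           ![-((p : ℤ) - 1), -((p : ℤ) - 1), -((p : ℤ) - 1)],
           ![1, 0, -(p : ℤ)]} : Set (Fin 3 → ℤ)) ∧
      ∀ a : Fin 3 → ℤ, a ∈ ZipCone.saturation (ZipCone.Czip 3 k p) ↔
        (a 0 ≥ a 1 ∧ a 1 ≥ a 2) ∧
        (p : ℤ) ^ 2 * a 0 + p * a 2 + a 1 ≤ 0 ∧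
        (p : ℤ) ^ 2 * a 1 + p * a 0 + a 2 ≤ 0 := by
  have : IsAlgClosed k := IsAlgClosure.isAlgClosed (ZMod p)
  rw [ZipCone.saturation_Czip_eq,
    ZipCone.sGenerated_eq_inequalityCone (Fact.out : p.Prime).one_lt]
  exact ⟨rfl, fun a => Iff.rfl⟩
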